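/- Let $(X,d)$ be a metric space that is strictly intrinsic, i.e. any two points $x_0,x_1$ are joined by a geodesic $\gamma:[0,1]\to X$, meaning $d(\gamma_s,\gamma_t)=|t-s|\,d(x_0,x_1)$ for all $s,t\in[0,1]$. (Completeness is not required.) Let $K\in\mathbb R$, $N<0$, let $f:X\to[-\infty,+\infty]$ be lower semicontinuous, $f_N:=e^{-f/N}\in[0,\infty]$ and $\mathcal D[f]:=\{f\ne\pm\infty\}$. Notation. Let $\mathfrak s_{K,N}(\theta)=\sin(\theta\sqrt{K/N})/\sqrt{K/N}$ if $K<0$, $=\theta$ if $K=0$, $=\sinh(\theta\sqrt{-K/N})/\sqrt{-K/N}$ if $K>0$. Let $\sigma^{(t)}_{K,N}(\theta)=t$ if $K\theta^2=0$, $=\infty$ if $K\theta^2\le N\pi^2$, and $=\mathfrak s_{K,N}(t\theta)/\mathfrak s_{K,N}(\theta)$ otherwise. * $f$ is $(K,N)$-convex if for all $x_0,x_1\in\{f<+\infty\}$ (with $d(x_0,x_1)<\pi\sqrt{N/K}$ when $K<0$) there is a geodesic $\gamma$ from $x_0$ to $x_1$ with $$f_N(\gamma_t)\le\sigma^{(1-t)}_{K,N}(d(x_0,x_1))f_N(x_0)+\sigma^{(t)}_{K,N}(d(x_0,x_1))f_N(x_1),\qquad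 t\in[0,1],$$ where $0\cdot\infty=0$. * An $\mathrm{EVI}_{K,N}$ gradient curve for $f$ is a continuous curve $(y_t)_{t\in(0,T)}$ in $\mathcal D[f]$, $T\in(0,+\infty]$, such that for every $t\in(0,T)$ and every $z$ with $f(z)<+\infty$ (and $d(y_t,z)<\pi\sqrt{N/K}$ when $K<0$) $$\frac{d^+}{dt}\Big[\mathfrak s_{K,N}\big(\tfrac{d(y_t,z)}2\big)^2\Big]+K\,\mathfrak s_{K,N}\big(\tfrac{d(y_t,z)}2\big)^2\le\frac N2\Big(1-\frac{f_N(z)}{f_N(y_t)}\Big),$$ where $\frac{d^+}{dt}$ is the upper right derivative. It starts at $y_0\in X$ if $\lim_{t\downarrow0}y_t=y_0$. * For such a curve let $\alpha(t)=-N\int_0^t f_N(y_r)^{-1}\,dr$, $T'=\lim_{t\uparrow T}\alpha(t)$, let $\varphi:(0,T')\to(0,T)$ be the inverse of $\alpha$, and $\mathcal R_1(y)=(y_{\varphi(s)})_{s\in(0,T')}$. * For $M\in\mathbb R$ let $\tilde M:=-\frac KN e^{-M/N}$. Theorem. Let $(y_t)_{t\in(0,T)}$, $(\tilde y_t)_{t\in(0,\tilde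 T)}$ be two $\mathrm{EVI}_{K,N}$ gradient curves for $f$, and let $(z_s)_{s\in(0,T')}$, $(\tilde z_s)_{s\in(0,\tilde T')}$ be their reparametrizations by $\mathcal R_1$. (i) If $K\ge0$, then $d(z_s,\tilde z_s)\le d(z_r,\tilde z_r)$ for all $0<r\le s<\min\{T',\tilde T'\}$. (ii) If $K<0$ and $f$ is $(K,N)$-convex and $f\le M$ on $X$ for some $M\in\mathbb R$, then $d(z_s,\tilde z_s)\le e^{-\tilde M(s-r)}d(z_r,\tilde z_r)$ for all $0<r\le s<\min\{T',\tilde T'\}$. (iii) If $K<0$, then for every $c>1$ there is a constant $R>0$, depending only on $K$, $N$ and $c$, with the following property: if $d(z_r,\tilde z_r)<R/3$ for some $r\in(0,\min\{T',\tilde T'\})$, then there is $\varepsilon>0$ with $r+\varepsilon\le\min\{T',\tilde T'\}$ such that $$d(z_s,\tilde z_s)\le e^{-c\tilde M(s-r)}d(z_r,\tilde z_r)\qquad\text{for all } r\le s<r+\varepsilon,$$ where $M:=\max\{f(z_r),f(\tilde z_r)\}$. Moreover, any two $\mathrm{EVI}_{K,N}$ gradient curves for $f$ that start from the same point $y_0$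 agree on their common interval of definition, in each of these cases: $y_0\in\mathcal D[f]$ ($K$ arbitrary); $K\ge0$ and $y_0\in X$ arbitrary; $K<0$, $f$ is $(K,N)$-convex and bounded above, and $y_0\in X$ arbitrary. -/

import Mathlib

open Set Filter Topology

noncomputable section

namespace EVI

/-- A geodesic: a constant speed curve `γ : [0,1] → X` realising the distance of its endpoints
(such a curve is automatically continuous). -/
def IsGeodesic {X : Type*} [MetricSpace X] (γ : unitInterval → X) : Prop :=
  ∀ s t : unitInterval, dist (γ s) (γ t) = |(t : ℝ) - (s : ℝ)| * dist (γ 0) (γ 1)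

/-- Every two points are joined by a geodesic (no completeness is required). -/
def IsStrictlyIntrinsic (X : Type*) [MetricSpace X] : Prop :=
  ∀ x₀ x₁ : X, ∃ γ : unitInterval → X, IsGeodesic γ ∧ γ 0 = x₀ ∧ γ 1 = x₁

/-- The finiteness domain `{x | f x ≠ ±∞}`. -/
def finDom {X : Type*} (f : X → EReal) : Set X := {x | f x ≠ ⊥ ∧ f x ≠ ⊤}

/-- The extended domain `{x | f x < +∞}`; the value `-∞` is allowed. -/
def extDom {X : Type*} (f : X → EReal) : Set X := {x | f x < ⊤}

/-- `f_N = exp (-f / N)` with values in `[0, ∞]`. For `N < 0` it is `0` where `f = -∞` and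
`∞` where `f = +∞`. -/
def fN {X : Type*} (N : ℝ) (f : X → EReal) (x : X) : ENNReal := EReal.exp (-(f x) / (N : EReal))

/-- The generalised sine `𝔰_{K,N}` (for `N < 0`). -/
def genSin (K N θ : ℝ) : ℝ :=
  if K < 0 then Real.sin (θ * √(K / N)) / √(K / N)
  else if K = 0 then θ
  else Real.sinh (θ * √(-K / N)) / √(-K / N)

/-- The distortion coefficient `σ_{K,N}^{(t)}(θ)`, with values in `[0, ∞]`. -/
def distortion (K N t θ : ℝ) : ENNReal :=
  if K * θ ^ 2 = 0 then ENNReal.ofReal t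
  else if K * θ ^ 2 ≤ N * Real.pi ^ 2 then ⊤
  else ENNReal.ofReal (genSin K N (t * θ) / genSin K N θ)

/-- `(K,N)`-convexity of `f : X → [-∞, ∞]` for `N < 0`. The inequality is one in `[0, ∞]`, where
`0 * ∞ = 0`. -/
def IsKNConvex {X : Type*} [MetricSpace X] (K N : ℝ) (f : X → EReal) : Prop :=
  ∀ x₀ ∈ extDom f, ∀ x₁ ∈ extDom f,
    (K < 0 → dist x₀ x₁ < Real.pi * √(N / K)) →
    ∃ γ : unitInterval → X, IsGeodesic γ ∧ γ 0 = x₀ ∧ γ 1 = x₁ ∧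
      ∀ t : unitInterval,
        fN N f (γ t) ≤ distortion K N (1 - (t : ℝ)) (dist x₀ x₁) * fN N f x₀
          + distortion K N (t : ℝ) (dist x₀ x₁) * fN N f x₁

/-- The upper right derivative `limsup_{h ↓ 0} (F (t + h) - F t) / h`, an extended real. -/
def upperRightDeriv (F : ℝ → ℝ) (t : ℝ) : EReal :=
  limsup (fun h : ℝ => (((F (t + h) - F t) / h : ℝ) : EReal)) (𝓝[>] (0 : ℝ))

/-- The open time interval `(0, T)`, where `T` may be `+∞`. -/
def timeDom (T : EReal) : Set ℝ := {t : ℝ | 0 < t ∧ (t : EReal) < T}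

/-- `(y_t)_{t ∈ (0,T)}`, `0 < T ≤ ∞`, is an `EVI_{K,N}` gradient curve for `f` (for `N < 0`). Only
the values of `y` on `(0, T)` matter. The two values of `fN` in the inequality are finite, and the
one in the denominator is positive. -/
structure IsEVICurve {X : Type*} [MetricSpace X] (K N : ℝ) (f : X → EReal) (T : EReal)
    (y : ℝ → X) : Prop where
  pos : 0 < T
  continuousOn : ContinuousOn y (timeDom T)
  mem_finDom : ∀ t ∈ timeDom T, y t ∈ finDom f
  evi : ∀ t ∈ timeDom T, ∀ z ∈ extDom f, (K < 0 → dist (y t) z < Real.pi * √(N / K)) →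
    upperRightDeriv (fun u => genSin K N (dist (y u) z / 2) ^ 2) t
        + ((K * genSin K N (dist (y t) z / 2) ^ 2 : ℝ) : EReal)
      ≤ ((N / 2 * (1 - (fN N f z).toReal / (fN N f (y t)).toReal) : ℝ) : EReal)

/-- The curve starts at `y₀`. -/
def StartsAt {X : Type*} [MetricSpace X] (y : ℝ → X) (y₀ : X) : Prop :=
  Tendsto y (𝓝[>] (0 : ℝ)) (𝓝 y₀)

/-- The change of time `α(t) = -N ∫_0^t 1 / f_N(y_r) dr`. Along a curve on which `f` is finite and
non-increasing, the integrand is bounded on `(0, t)`, and `α` is strictly increasing. -/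
def alpha {X : Type*} (N : ℝ) (f : X → EReal) (y : ℝ → X) (t : ℝ) : ℝ :=
  -N * ∫ r in (0 : ℝ)..t, 1 / (fN N f (y r)).toReal

/-- The final time `T' = lim_{t ↑ T} α(t)` of the reparametrized curve; the limit is written as
the supremum, as `α` is increasing. -/
def newTime {X : Type*} (N : ℝ) (f : X → EReal) (T : EReal) (y : ℝ → X) : EReal :=
  ⨆ t ∈ timeDom T, (alpha N f y t : EReal)

/-- The reparametrization `R₁`: `z_s = y_{φ(s)}` for `s ∈ (0, T')`, where `φ : (0, T') → (0, T)` is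
the inverse of `α : (0, T) → (0, T')`. -/
def reparam {X : Type*} (N : ℝ) (f : X → EReal) (T : EReal) (y : ℝ → X) (s : ℝ) : X :=
  y (Function.invFunOn (alpha N f y) (timeDom T) s)

/-- `M̃ = -(K / N) exp (-M / N)`. -/
def rate (K N M : ℝ) : ℝ := -(K / N) * Real.exp (-M / N)

/-- There is at most one `EVI_{K,N}` gradient curve for `f` starting from `y₀`: any two of them
agree as long as both are defined. -/
def UniqueFrom {X : Type*} [MetricSpace X] (K N : ℝ) (f : X → EReal) (y₀ : X) : Prop :=
  ∀ (T₁ T₂ : EReal) (y₁ y₂ : ℝ → X),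
    IsEVICurve K N f T₁ y₁ → IsEVICurve K N f T₂ y₂ → StartsAt y₁ y₀ → StartsAt y₂ y₀ →
    ∀ t ∈ timeDom (min T₁ T₂), y₁ t = y₂ t

end EVI

end

/-! Write F for f_N and h for the square of 𝔰_{K,N}(d/2). In the time s with ds = -N/F(y_t) dt, the
EVI becomes D⁺h(z_s, w) ≤ (F(w) - F(z_s)(1 - 2(K/N)h(z_s, w)))/2, which is linear in F. Testing each
of two curves against the other and adding, the differences F(z) - F(z̃) cancel, and D⁺h ≤
(K/N)(F(z) + F(z̃))h remains (`dini_dist`).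

For K ≥ 0 the coefficient is nonpositive, so h and hence d decrease: this is (i). For K < 0, F is
nonincreasing along the curves, so Grönwall bounds the growth of sin(√(K/N)d/2) by the rate (K/N)
max F. Replacing the sine by its argument costs a factor c in the exponent as long as the cosine
stays above 1/c; this is (iii).

In (ii) the distance may exceed the range in which the EVI applies. A chain of points with equal
short steps is therefore placed between z_s and z̃_s, and each curve is tested only against its
neighbour in the chain. The chain almost minimises the sum of F over its points, so midpoint
convexity holds approximately at every interior point (`exists_chain`). Summing these inequalities
controls the two end contributions by the global bound of F (`sum_discrete_convex`), and an
elementary trigonometric inequality gives the exact rate, with no limit of fine chains.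

For uniqueness, the estimates from time a to time s are used with a ↓ 0. When y₀ has finite energy,
F(y₀) bounds F on both curves and the short-time Grönwall estimate suffices. Equal rescaled curves
have equal clocks, since the clock has right derivative F(z_s)/(-N) and starts from 0; so the
original curves agree. -/

namespace EVI

/-- The upper right Dini derivative of `u` at `t` is at most `b`. -/
def DiniLE (u : ℝ → ℝ) (t b : ℝ) : Prop :=
  ∀ c, b < c → ∀ᶠ x in 𝓝[>] t, u x - u t ≤ c * (x - t)

/-! ### Calculus of upper right Dini derivatives -/

namespace DiniLE

variable {u v : ℝ → ℝ} {t b b' : ℝ}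

lemma mono (h : DiniLE u t b) (hb : b ≤ b') : DiniLE u t b' :=
  fun c hc => h c (hb.trans_lt hc)

lemma of_forall_lt (h : ∀ c, b < c → DiniLE u t c) : DiniLE u t b := by
  intro c hc
  obtain ⟨d, hbd, hdc⟩ := exists_between hc
  exact h d hbd c hdc

lemma add (hu : DiniLE u t b) (hv : DiniLE v t b') : DiniLE (fun x => u x + v x) t (b + b') := by
  intro c hc
  have h1 := hu (b + (c - (b + b')) / 2) (by linarith)
  have h2 := hv (b' + (c - (b + b')) / 2) (by linarith)
  filter_upwards [h1, h2] with x hx1 hx2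
  have : c * (x - t) = (b + (c - (b + b')) / 2) * (x - t) + (b' + (c - (b + b')) / 2) * (x - t) := by
    ring
  rw [this]; linarith

lemma of_le (hv : DiniLE v t b) (h : ∀ᶠ x in 𝓝[>] t, u x - u t ≤ v x - v t) : DiniLE u t b := by
  intro c hc
  filter_upwards [hv c hc, h] with x h1 h2 using h2.trans h1

lemma of_upperRightDeriv {a : ℝ}
    (h : upperRightDeriv u t + ((a : ℝ) : EReal) ≤ ((b : ℝ) : EReal)) : DiniLE u t (b - a) := by
  intro c hc
  have h1 : upperRightDeriv u t < (c : EReal) := by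
    have h2 : upperRightDeriv u t ≤ ((b - a : ℝ) : EReal) := by
      rw [EReal.coe_sub]
      exact (EReal.le_sub_iff_add_le (by simp) (by simp)).2 h
    exact h2.trans_lt (by exact_mod_cast hc)
  have h2 := eventually_lt_of_limsup_lt h1
  have h3 : Tendsto (fun x => x - t) (𝓝[>] t) (𝓝[>] (0 : ℝ)) := by
    refine tendsto_nhdsWithin_iff.2 ⟨?_, ?_⟩
    · have : Tendsto (fun x => x - t) (𝓝 t) (𝓝 (t - t)) := (continuous_id.sub continuous_const).tendsto t
      rw [sub_self] at this
      exact this.mono_left nhdsWithin_le_nhds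
    · filter_upwards [self_mem_nhdsWithin] with x hx
      exact sub_pos.2 (mem_Ioi.1 hx)
  filter_upwards [h3.eventually h2, self_mem_nhdsWithin] with x hx hxt
  have hxt' : 0 < x - t := sub_pos.2 (mem_Ioi.1 hxt)
  have hx' : (u (t + (x - t)) - u t) / (x - t) < c := by exact_mod_cast hx
  rw [add_sub_cancel] at hx'
  exact ((div_lt_iff₀ hxt').1 hx').le

lemma frequently (h : DiniLE u t b) (r : ℝ) (hr : b < r) :
    ∃ᶠ z in 𝓝[>] t, (z - t)⁻¹ * (u z - u t) < r := by
  obtain ⟨c, hbc, hcr⟩ := exists_between hr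
  refine Eventually.frequently ?_
  filter_upwards [h c hbc, self_mem_nhdsWithin] with x hx hxt
  have hxt' : 0 < x - t := sub_pos.2 (mem_Ioi.1 hxt)
  refine lt_of_le_of_lt ?_ hcr
  rw [inv_mul_le_iff₀ hxt']; linarith

/-- Grönwall's inequality for Dini derivatives. -/
lemma gronwall {a b L : ℝ} (hab : a ≤ b) (hu : ContinuousOn u (Icc a b))
    (h : ∀ x ∈ Ico a b, DiniLE u x (L * u x)) : u b ≤ Real.exp (L * (b - a)) * u a := by
  have := le_gronwallBound_of_liminf_deriv_right_le (f' := fun x => L * u x) (δ := u a) (K := L)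
    (ε := 0) hu (fun x hx r hr => (h x hx).frequently r hr) le_rfl
    (fun x _ => by simp) b (right_mem_Icc.2 hab)
  rw [gronwallBound_ε0] at this
  linarith

lemma sub_le {a b c : ℝ} (hab : a ≤ b) (hu : ContinuousOn u (Icc a b))
    (h : ∀ x ∈ Ico a b, DiniLE u x c) : u b - u a ≤ c * (b - a) := by
  have := le_gronwallBound_of_liminf_deriv_right_le (f' := fun _ => c) (δ := u a) (K := 0)
    (ε := c) hu (fun x hx r hr => (h x hx).frequently r hr) le_rfl
    (fun x _ => by simp) b (right_mem_Icc.2 hab)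
  rw [gronwallBound_K0] at this
  linarith

/-- A chain rule read backwards: it turns a bound for a function of the distance into one for the
distance itself. -/
lemma of_comp {p : ℝ → ℝ} {p' : ℝ} (h : DiniLE (fun x => p (u x)) t b)
    (hp : HasDerivAt p p' (u t)) (hp' : 0 < p') (hu : ContinuousWithinAt u (Ioi t) t) :
    DiniLE u t (b / p') := by
  intro c hc
  have hbc : b < c * p' := (div_lt_iff₀ hp').1 hc
  obtain ⟨d, hbd, hdc⟩ := exists_between hbc
  -- `dslope` rather than a quotient, since u x may equal u t.
  have h1 : Tendsto (fun x => dslope p (u t) (u x)) (𝓝[>] t) (𝓝 p') := by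
    have h2 : ContinuousAt (dslope p (u t)) (u t) :=
      continuousAt_dslope_same.2 hp.differentiableAt
    have h3 : dslope p (u t) (u t) = p' := by rw [dslope_same, hp.deriv]
    have := h2.tendsto.comp hu.tendsto
    rwa [h3] at this
  have h4 : ∀ᶠ x in 𝓝[>] t, d < c * dslope p (u t) (u x) :=
    (h1.const_mul c).eventually_const_lt hdc
  filter_upwards [h d hbd, h4, h1.eventually_const_lt hp', self_mem_nhdsWithin] with x hx hd hpos hxt
  have hxt' : 0 < x - t := sub_pos.2 (mem_Ioi.1 hxt)
  have h5 : (u x - u t) * dslope p (u t) (u x) = p (u x) - p (u t) := by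
    have := sub_smul_dslope p (u t) (u x)
    simpa using this
  have h6 : (u x - u t) * dslope p (u t) (u x) ≤ (c * (x - t)) * dslope p (u t) (u x) := by
    rw [h5]
    refine hx.trans ?_
    have := mul_le_mul_of_nonneg_right hd.le hxt'.le
    linarith
  exact le_of_mul_le_mul_right h6 hpos

/-- Change of time by a strictly increasing function with a positive right derivative. -/
lemma comp_time {φ : ℝ → ℝ} {s φ' : ℝ} (h : DiniLE u (φ s) b)
    (hφ : HasDerivWithinAt φ φ' (Ioi s) s) (hmono : ∀ᶠ x in 𝓝[>] s, φ s < φ x) (hφ' : 0 < φ') :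
    DiniLE (fun x => u (φ x)) s (b * φ') := by
  intro c hc
  obtain ⟨d, hbd, hdc⟩ := exists_between ((lt_div_iff₀ hφ').2 hc)
  have hdc' : d * φ' < c := (lt_div_iff₀ hφ').1 hdc
  have h1 : Tendsto φ (𝓝[>] s) (𝓝[>] (φ s)) :=
    tendsto_nhdsWithin_iff.2 ⟨hφ.continuousWithinAt.tendsto, hmono⟩
  have h2 : Tendsto (slope φ s) (𝓝[>] s) (𝓝 φ') :=
    (hasDerivWithinAt_iff_tendsto_slope' (by simp)).1 hφ
  filter_upwards [h1.eventually (h d hbd), (h2.const_mul d).eventually_lt_const hdc',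
    self_mem_nhdsWithin] with x hx hs hxt
  have hxt' : 0 < x - s := sub_pos.2 (mem_Ioi.1 hxt)
  refine hx.trans ?_
  have h3 : slope φ s x * (x - s) = φ x - φ s := by
    rw [slope_def_field]; field_simp
  rw [← h3, ← mul_assoc]
  exact mul_le_mul_of_nonneg_right hs.le hxt'.le

/-- Upper right derivative along the diagonal of a function of two variables. -/
lemma diag {U a b : ℝ → ℝ → ℝ} {s ε : ℝ} (hε : 0 < ε)
    (hU₁ : ∀ t ∈ Ico s (s + ε), ContinuousOn (fun r => U r t) (Ico s (s + ε)))
    (hU₂ : ∀ r ∈ Ico s (s + ε), ContinuousOn (fun t => U r t) (Ico s (s + ε)))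
    (h₁ : ∀ r ∈ Ico s (s + ε), ∀ t ∈ Ico s (s + ε), DiniLE (fun r => U r t) r (a r t))
    (h₂ : ∀ r ∈ Ico s (s + ε), ∀ t ∈ Ico s (s + ε), DiniLE (fun t => U r t) t (b r t))
    (ha : Tendsto (fun q : ℝ × ℝ => a q.1 q.2) (𝓝[≥] s ×ˢ 𝓝[≥] s) (𝓝 (a s s)))
    (hb : Tendsto (fun q : ℝ × ℝ => b q.1 q.2) (𝓝[≥] s ×ˢ 𝓝[≥] s) (𝓝 (b s s))) :
    DiniLE (fun x => U x x) s (a s s + b s s) := by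
  intro c hc
  set η := (c - (a s s + b s s)) / 2 with hη
  have hηpos : 0 < η := by rw [hη]; linarith
  -- Joint right continuity makes the partial bounds uniform on a small square. The diagonal
  -- increment is then split at U s x, and each half is integrated in one variable.
  have key : ∀ᶠ q in 𝓝[≥] s ×ˢ 𝓝[≥] s, a q.1 q.2 < a s s + η ∧ b q.1 q.2 < b s s + η :=
    (ha.eventually_lt_const (by linarith)).and (hb.eventually_lt_const (by linarith))
  have hprod : (𝓝[≥] s ×ˢ 𝓝[≥] s).HasBasis (fun e : ℝ => s < e) (fun e => Ico s e ×ˢ Ico s e) :=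
    (nhdsGE_basis s).prod_self
  obtain ⟨e, hse, he⟩ := hprod.eventually_iff.1 key
  have hmem : Ioo s (min e (s + ε)) ∈ 𝓝[>] s := Ioo_mem_nhdsGT (lt_min hse (by linarith))
  filter_upwards [hmem] with x hx
  have hxe : x < e := hx.2.trans_le (min_le_left _ _)
  have hxε : x < s + ε := hx.2.trans_le (min_le_right _ _)
  have hxs : x ∈ Ico s (s + ε) := ⟨hx.1.le, hxε⟩
  have hss : s ∈ Ico s (s + ε) := ⟨le_rfl, by linarith⟩
  have hsub : Icc s x ⊆ Ico s (s + ε) := fun r hr => ⟨hr.1, hr.2.trans_lt hxε⟩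
  have e1 : U x x - U s x ≤ (a s s + η) * (x - s) := by
    refine DiniLE.sub_le (u := fun r => U r x) hx.1.le ((hU₁ x hxs).mono hsub) fun r hr => ?_
    refine (h₁ r (hsub (Ico_subset_Icc_self hr)) x hxs).mono ?_
    exact (he (x := (r, x)) ⟨⟨hr.1, hr.2.trans hxe⟩, ⟨hx.1.le, hxe⟩⟩).1.le
  have e2 : U s x - U s s ≤ (b s s + η) * (x - s) := by
    refine DiniLE.sub_le (u := fun r => U s r) hx.1.le ((hU₂ s hss).mono hsub) fun r hr => ?_
    refine (h₂ s hss r (hsub (Ico_subset_Icc_self hr))).mono ?_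
    exact (he (x := (s, r)) ⟨⟨le_rfl, hse⟩, ⟨hr.1, hr.2.trans hxe⟩⟩).2.le
  have : c = (a s s + η) + (b s s + η) := by rw [hη]; ring
  rw [this, add_mul]
  linarith

end DiniLE

end EVI

/-! ### The comparison function h, the values of f_N, and time intervals -/

namespace EVI

/-- The function `𝔰_{K,N}(d / 2)²` of a distance `d`. -/
noncomputable def halfSq (K N d : ℝ) : ℝ := genSin K N (d / 2) ^ 2

/-- The restriction on the distance in the case `K < 0`. -/
def Admissible (K N d : ℝ) : Prop := K < 0 → d < Real.pi * √(N / K)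

section Scalar

variable {K N : ℝ}

lemma continuous_genSin : Continuous (genSin K N) := by
  unfold genSin
  split_ifs <;> fun_prop

lemma continuous_halfSq : Continuous (halfSq K N) :=
  (continuous_genSin.comp (continuous_id.div_const 2)).pow 2

lemma halfSq_nonneg (d : ℝ) : 0 ≤ halfSq K N d := sq_nonneg _

@[simp] lemma halfSq_zero : halfSq K N 0 = 0 := by
  simp [halfSq, genSin]

lemma sqrt_div_pos (hN : N < 0) (hK : K < 0) : 0 < √(K / N) :=
  Real.sqrt_pos.2 (div_pos_of_neg_of_neg hK hN)

lemma sq_sqrt_div (hN : N < 0) (hK : K < 0) : √(K / N) ^ 2 = K / N :=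
  Real.sq_sqrt (div_pos_of_neg_of_neg hK hN).le

lemma pi_mul_sqrt : Real.pi * √(N / K) = Real.pi / √(K / N) := by
  rw [← inv_div K N, Real.sqrt_inv, ← div_eq_mul_inv]

lemma admissible_iff_of_neg (hN : N < 0) (hK : K < 0) {d : ℝ} :
    Admissible K N d ↔ √(K / N) * d < Real.pi := by
  rw [Admissible, pi_mul_sqrt, lt_div_iff₀ (sqrt_div_pos hN hK), mul_comm]
  exact ⟨fun h => h hK, fun h _ => h⟩

lemma admissible_of_nonneg (hK : 0 ≤ K) (d : ℝ) : Admissible K N d := fun h => absurd h (not_lt.2 hK)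

lemma admissible_zero (hN : N < 0) : Admissible K N 0 := fun hK =>
  mul_pos Real.pi_pos (Real.sqrt_pos.2 (div_pos_of_neg_of_neg hN hK))

lemma Admissible.eventually {d : ℝ} (h : Admissible K N d) : ∀ᶠ e in 𝓝 d, Admissible K N e := by
  by_cases hK : K < 0
  · filter_upwards [gt_mem_nhds (h hK)] with e he _ using he
  · exact Eventually.of_forall fun e h => absurd h hK

lemma halfSq_of_neg (hK : K < 0) (d : ℝ) :
    halfSq K N d = Real.sin (√(K / N) * d / 2) ^ 2 / √(K / N) ^ 2 := by
  rw [halfSq, genSin, if_pos hK, div_pow]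
  congr 3; ring

lemma genSin_strictMono (hN : N < 0) (hK : 0 ≤ K) : StrictMono (genSin K N) := by
  intro a b hab
  unfold genSin
  rcases hK.eq_or_lt with rfl | hK'
  · simpa using hab
  · have h : 0 < √(-K / N) := Real.sqrt_pos.2 (div_pos_of_neg_of_neg (by linarith) hN)
    rw [if_neg hK.not_gt, if_neg hK'.ne', if_neg hK.not_gt, if_neg hK'.ne']
    gcongr
    exact Real.sinh_strictMono (by gcongr)

lemma genSin_zero : genSin K N 0 = 0 := by simp [genSin]

lemma le_of_halfSq_le (hN : N < 0) (hK : 0 ≤ K) {d e : ℝ} (he : 0 ≤ e)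
    (h : halfSq K N d ≤ halfSq K N e) : d ≤ e := by
  have h0 : 0 ≤ genSin K N (e / 2) := by
    rw [← genSin_zero (K := K) (N := N)]
    exact (genSin_strictMono hN hK).monotone (by linarith)
  have := (genSin_strictMono hN hK).le_iff_le.1 ((le_abs_self _).trans (abs_le_of_sq_le_sq h h0))
  linarith

/-- For K < 0 admissibility keeps the angle √(K/N)d/2 below π, so the sine vanishes only at d = 0.
-/
lemma eq_zero_of_halfSq_le_zero (hN : N < 0) {d : ℝ} (hd : 0 ≤ d) (hA : Admissible K N d)
    (h : halfSq K N d ≤ 0) : d = 0 := by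
  rcases lt_or_ge K 0 with hK | hK
  · have hk := sqrt_div_pos hN hK
    rw [admissible_iff_of_neg hN hK] at hA
    rw [halfSq_of_neg hK] at h
    have h1 : Real.sin (√(K / N) * d / 2) ^ 2 ≤ 0 := by
      rwa [div_le_iff₀ (by positivity), zero_mul] at h
    have h2 : Real.sin (√(K / N) * d / 2) = 0 := by
      have := sq_nonneg (Real.sin (√(K / N) * d / 2))
      exact pow_eq_zero_iff two_ne_zero |>.1 (le_antisymm h1 this)
    by_contra hne
    have hd' : 0 < √(K / N) * d := mul_pos hk (lt_of_le_of_ne hd (Ne.symm hne))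
    exact (Real.sin_pos_of_pos_of_lt_pi (by linarith) (by linarith)).ne' h2
  · exact le_antisymm (le_of_halfSq_le hN hK le_rfl (h.trans_eq halfSq_zero.symm)) hd

end Scalar

/-- The real number `f_N(x)`, where `f x < ∞`. -/
noncomputable def expVal {X : Type*} (N : ℝ) (f : X → EReal) (x : X) : ℝ := (fN N f x).toReal

section ExpVal

variable {X : Type*} {N : ℝ} {f : X → EReal} {x x' : X}

lemma finDom_subset_extDom : finDom f ⊆ extDom f := fun _ hx => lt_top_iff_ne_top.2 hx.2

lemma expVal_nonneg : 0 ≤ expVal N f x := ENNReal.toReal_nonneg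

lemma neg_div_eq_mul (x : X) : -(f x) / (N : EReal) = f x * ((-N⁻¹ : ℝ) : EReal) := by
  rw [EReal.div_eq_inv_mul, ← EReal.coe_inv, mul_comm, EReal.neg_mul, EReal.coe_neg, mul_neg]

lemma fN_mono (hN : N < 0) (h : f x ≤ f x') : fN N f x ≤ fN N f x' := by
  have : (0 : EReal) ≤ ((-N⁻¹ : ℝ) : EReal) := by
    exact_mod_cast (neg_pos.2 (inv_lt_zero.2 hN)).le
  rw [fN, fN, EReal.exp_le_exp_iff, neg_div_eq_mul, neg_div_eq_mul]
  exact mul_le_mul_of_nonneg_right h this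

lemma fN_of_eq_coe {a : ℝ} (h : f x = a) : fN N f x = ENNReal.ofReal (Real.exp (-a / N)) := by
  rw [fN, h, ← EReal.exp_coe, EReal.coe_div, EReal.coe_neg]

lemma fN_le_of_le_coe (hN : N < 0) {a : ℝ} (h : f x ≤ a) :
    fN N f x ≤ ENNReal.ofReal (Real.exp (-a / N)) := by
  rw [← fN_of_eq_coe (f := fun _ : X => (a : EReal)) (x := x) rfl]
  -- `fN_mono` compares two values of one function; a function on `Bool` takes both f x and a.
  have := fN_mono (f := fun b : Bool => if b then f x else a) (x := true) (x' := false) hN (by simpa)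
  simpa [fN] using this

lemma expVal_le_of_le_coe (hN : N < 0) {a : ℝ} (h : f x ≤ a) :
    expVal N f x ≤ Real.exp (-a / N) :=
  ENNReal.toReal_le_of_le_ofReal (Real.exp_pos _).le (fN_le_of_le_coe hN h)

lemma fN_ne_top (hN : N < 0) (hx : x ∈ extDom f) : fN N f x ≠ ⊤ := by
  obtain ⟨a, ha, -⟩ := EReal.lt_iff_exists_real_btwn.1 (show f x < ⊤ from hx)
  exact ((fN_le_of_le_coe hN ha.le).trans_lt ENNReal.ofReal_lt_top).ne

lemma expVal_mono (hN : N < 0) (hx' : x' ∈ extDom f) (h : f x ≤ f x') :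
    expVal N f x ≤ expVal N f x' :=
  ENNReal.toReal_mono (fN_ne_top hN hx') (fN_mono hN h)

lemma expVal_of_mem (hx : x ∈ finDom f) : expVal N f x = Real.exp (-(f x).toReal / N) := by
  rw [expVal, fN_of_eq_coe (EReal.coe_toReal hx.2 hx.1).symm,
    ENNReal.toReal_ofReal (Real.exp_pos _).le]

lemma expVal_pos (hx : x ∈ finDom f) : 0 < expVal N f x := by
  rw [expVal_of_mem hx]; exact Real.exp_pos _

lemma lt_coe_iff_expVal_lt (hN : N < 0) (hx : x ∈ finDom f) {a : ℝ} :
    (a : EReal) < f x ↔ Real.exp (-a / N) < expVal N f x := by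
  rw [expVal_of_mem hx, Real.exp_lt_exp, div_lt_div_right_of_neg hN, neg_lt_neg_iff]
  nth_rw 1 [← EReal.coe_toReal hx.2 hx.1]
  exact EReal.coe_lt_coe_iff

/-- As N < 0, f_N is increasing in f and inherits its lower semicontinuity. The level c > 0 of f_N
corresponds to the level -N log c of f. -/
lemma eventually_lt_expVal [TopologicalSpace X] (hN : N < 0) (hf : LowerSemicontinuous f)
    {y : ℝ → X} {s : Set ℝ} {t : ℝ} (hy : ContinuousWithinAt y s t)
    (hfin : ∀ r ∈ s, y r ∈ finDom f) (ht : y t ∈ finDom f) {c : ℝ} (hc : c < expVal N f (y t)) :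
    ∀ᶠ r in 𝓝[s] t, c < expVal N f (y r) := by
  rcases le_or_gt c 0 with h0 | h0
  · filter_upwards [self_mem_nhdsWithin] with r hr using h0.trans_lt (expVal_pos (hfin r hr))
  · have hexp : Real.exp (-(-N * Real.log c) / N) = c := by
      rw [neg_mul, neg_neg, mul_div_cancel_left₀ _ hN.ne, Real.exp_log h0]
    have h1 : ((-N * Real.log c : ℝ) : EReal) < f (y t) := by
      rwa [lt_coe_iff_expVal_lt hN ht, hexp]
    filter_upwards [hy.eventually (hf _ _ h1), self_mem_nhdsWithin] with r hr hrs
    rwa [gt_iff_lt, lt_coe_iff_expVal_lt hN (hfin r hrs), hexp] at hr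

end ExpVal

section TimeDom

variable {T : EReal} {s t : ℝ}

lemma timeDom_of_le (ht : t ∈ timeDom T) (hs : 0 < s) (hst : s ≤ t) : s ∈ timeDom T :=
  ⟨hs, (EReal.coe_le_coe_iff.2 hst).trans_lt ht.2⟩

lemma exists_gt_mem_timeDom (ht : t ∈ timeDom T) : ∃ s ∈ timeDom T, t < s := by
  obtain ⟨s, h1, h2⟩ := EReal.lt_iff_exists_real_btwn.1 ht.2
  have h : t < s := by exact_mod_cast h1
  exact ⟨s, ⟨ht.1.trans h, h2⟩, h⟩

lemma isOpen_timeDom : IsOpen (timeDom T) :=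
  isOpen_Ioi.inter (isOpen_Iio.preimage continuous_coe_real_ereal)

lemma Icc_subset_timeDom (hs : 0 < s) (ht : t ∈ timeDom T) : Icc s t ⊆ timeDom T :=
  fun _ hr => timeDom_of_le ht (hs.trans_le hr.1) hr.2

end TimeDom

/-! ### Monotonicity of f along EVI curves -/

namespace IsEVICurve

variable {X : Type*} [MetricSpace X] {K N : ℝ} {f : X → EReal} {T : EReal} {y : ℝ → X}

lemma dini (hy : IsEVICurve K N f T y) {t : ℝ} (ht : t ∈ timeDom T) {z : X} (hz : z ∈ extDom f)
    (hA : Admissible K N (dist (y t) z)) :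
    DiniLE (fun u => halfSq K N (dist (y u) z)) t
      (N / 2 * (1 - expVal N f z / expVal N f (y t)) - K * halfSq K N (dist (y t) z)) :=
  DiniLE.of_upperRightDeriv (hy.evi t ht z hz hA)

lemma continuousAt (hy : IsEVICurve K N f T y) {t : ℝ} (ht : t ∈ timeDom T) : ContinuousAt y t :=
  hy.continuousOn.continuousAt (isOpen_timeDom.mem_nhds ht)

/-- While the curve is above the level of `z`, its distance to `z` obeys a Grönwall inequality. -/
lemma halfSq_le_exp_mul (hN : N < 0) (hy : IsEVICurve K N f T y) {a b : ℝ} (hab : a ≤ b)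
    (ha : 0 < a) (hb : b ∈ timeDom T) {z : X} (hz : z ∈ extDom f)
    (hA : ∀ r ∈ Ico a b, Admissible K N (dist (y r) z)) (hle : ∀ r ∈ Ico a b, f z ≤ f (y r)) :
    halfSq K N (dist (y b) z) ≤ Real.exp (-K * (b - a)) * halfSq K N (dist (y a) z) := by
  have hsub := Icc_subset_timeDom ha hb
  refine DiniLE.gronwall (u := fun r => halfSq K N (dist (y r) z)) hab
    (continuous_halfSq.comp_continuousOn (continuous_id.dist continuous_const |>.comp_continuousOn (hy.continuousOn.mono hsub)))
    fun r hr => ?_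
  have hr' := hsub (Ico_subset_Icc_self hr)
  refine (hy.dini hr' hz (hA r hr)).mono ?_
  have hpos := expVal_pos (N := N) (hy.mem_finDom r hr')
  have h1 : 1 ≤ expVal N f (y r) / expVal N f (y r) := by rw [div_self hpos.ne']
  have h2 : expVal N f z / expVal N f (y r) ≤ 1 :=
    (div_le_one hpos).2 (expVal_mono hN (finDom_subset_extDom (hy.mem_finDom r hr')) (hle r hr))
  nlinarith

/-- The function does not increase along the curve. -/
lemma antitoneOn (hN : N < 0) (hf : LowerSemicontinuous f) (hy : IsEVICurve K N f T y) :
    AntitoneOn (fun t => f (y t)) (timeDom T) := by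
  intro a ha b hb hab
  by_contra! hlt
  have hsub := Icc_subset_timeDom ha.1 hb
  have hcont := hy.continuousOn.mono hsub
  -- Let s be the last time at which the level of y a is not exceeded. Just after s the curve lies
  -- above the level of y s, so Grönwall with test point y s and initial distance 0 keeps it at y s,
  -- a contradiction.
  set A : Set ℝ := {r | r ∈ Icc a b ∧ f (y r) ≤ f (y a)} with hAdef
  have hAc : IsClosed A := by
    have h := hcont.preimage_isClosed_of_isClosed isClosed_Icc (hf.isClosed_preimage (f (y a)))
    exact h
  have haA : a ∈ A := ⟨⟨le_rfl, hab⟩, le_rfl⟩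
  have hbdd : BddAbove A := ⟨b, fun r hr => hr.1.2⟩
  have hsA := hAc.csSup_mem ⟨a, haA⟩ hbdd
  set s := sSup A
  have hsT : s ∈ timeDom T := hsub hsA.1
  have hsb : s < b := lt_of_le_of_ne hsA.1.2 fun h => absurd hsA.2 (by rw [h]; exact not_le.2 hlt)
  have habove : ∀ r, s < r → r ≤ b → f (y a) < f (y r) := fun r hr hrb => by
    by_contra! hcon
    exact absurd (le_csSup hbdd (show r ∈ A from ⟨⟨hsA.1.1.trans hr.le, hrb⟩, hcon⟩)) (not_le.2 hr)
  have hAdm : ∀ᶠ r in 𝓝 s, Admissible K N (dist (y r) (y s)) := by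
    have h1 : Tendsto (fun r => dist (y r) (y s)) (𝓝 s) (𝓝 0) := by
      have := (hy.continuousAt hsT).tendsto.dist (tendsto_const_nhds (x := y s))
      rwa [dist_self] at this
    exact h1.eventually (admissible_zero hN).eventually
  obtain ⟨e, he, hball⟩ := Metric.eventually_nhds_iff.1 hAdm
  set b' := min b (s + e / 2)
  have hsb' : s < b' := lt_min hsb (by linarith)
  have hA : ∀ r ∈ Icc s b', Admissible K N (dist (y r) (y s)) := fun r hr => by
    refine hball ?_
    rw [Real.dist_eq, abs_of_nonneg (by linarith [hr.1])]
    linarith [hr.2.trans (min_le_right b (s + e / 2))]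
  have key := hy.halfSq_le_exp_mul hN hsb'.le hsT.1
    (timeDom_of_le hb (hsT.1.trans hsb') (min_le_left _ _))
    (finDom_subset_extDom (hy.mem_finDom s hsT)) (fun r hr => hA r (Ico_subset_Icc_self hr))
    (fun r hr => by
      rcases hr.1.eq_or_lt with rfl | h
      · exact le_rfl
      · exact hsA.2.trans (habove r h (hr.2.le.trans (min_le_left _ _))).le)
  rw [dist_self, halfSq_zero, mul_zero] at key
  have h0 := eq_zero_of_halfSq_le_zero hN dist_nonneg (hA b' ⟨hsb'.le, le_rfl⟩) key
  have h1 := habove b' hsb' (min_le_left _ _)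
  rw [dist_eq_zero.1 h0] at h1
  exact absurd hsA.2 (not_le.2 h1)

/-- A curve that starts from `y₀` stays below the level of `y₀`. -/
lemma le_of_startsAt (hN : N < 0) (hf : LowerSemicontinuous f) (hy : IsEVICurve K N f T y) {y₀ : X}
    (h₀ : y₀ ∈ extDom f) (hs : StartsAt y y₀) {t : ℝ} (ht : t ∈ timeDom T) : f (y t) ≤ f y₀ := by
  by_contra! hlt
  have hd : Tendsto (fun r => dist (y r) y₀) (𝓝[>] 0) (𝓝 0) := by
    have := hs.dist (tendsto_const_nhds (x := y₀))
    rwa [dist_self] at this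
  have hAdm := hd.eventually (admissible_zero (K := K) hN).eventually
  obtain ⟨e, he, hA⟩ := (nhdsGT_basis (0 : ℝ)).eventually_iff.1 hAdm
  have he0 : (0 : ℝ) < e := he
  set b := min t (e / 2)
  have hb : 0 < b := lt_min ht.1 (by linarith)
  have hbe : b < e := (min_le_right _ _).trans_lt (by linarith)
  have hbT : b ∈ timeDom T := timeDom_of_le ht hb (min_le_left _ _)
  -- By monotonicity the curve is above the level of y₀ at all earlier times too, so Grönwall with
  -- test point y₀ applies on [a, b], and a ↓ 0 forces y b = y₀.
  have habove : ∀ r, 0 < r → r ≤ b → f y₀ < f (y r) := fun r hr hrb =>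
    hlt.trans_le (hy.antitoneOn hN hf (timeDom_of_le hbT hr hrb) ht (hrb.trans (min_le_left _ _)))
  have key : ∀ᶠ a in 𝓝[>] 0, halfSq K N (dist (y b) y₀) ≤
      Real.exp (-K * (b - a)) * halfSq K N (dist (y a) y₀) := by
    filter_upwards [Ioo_mem_nhdsGT hb] with a ha
    refine hy.halfSq_le_exp_mul hN ha.2.le ha.1 hbT h₀ (fun r hr => ?_) fun r hr => ?_
    · exact hA ⟨ha.1.trans_le hr.1, hr.2.trans hbe⟩
    · exact (habove r (ha.1.trans_le hr.1) hr.2.le).le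
  have hlim : Tendsto (fun a => Real.exp (-K * (b - a)) * halfSq K N (dist (y a) y₀)) (𝓝[>] 0)
      (𝓝 (Real.exp (-K * (b - 0)) * halfSq K N 0)) := by
    refine Tendsto.mul ?_ ((continuous_halfSq.tendsto 0).comp hd)
    exact ((Continuous.tendsto (by fun_prop) 0).mono_left nhdsWithin_le_nhds)
  have h1 := ge_of_tendsto hlim key
  rw [halfSq_zero, mul_zero] at h1
  have h2 := eq_zero_of_halfSq_le_zero hN dist_nonneg (hA ⟨hb, hbe⟩) h1
  have h3 := habove b hb le_rfl
  rw [dist_eq_zero.1 h2] at h3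
  exact lt_irrefl _ h3

lemma expVal_antitoneOn (hN : N < 0) (hf : LowerSemicontinuous f) (hy : IsEVICurve K N f T y) :
    AntitoneOn (fun t => expVal N f (y t)) (timeDom T) := fun _ ha _ hb hab =>
  expVal_mono hN (finDom_subset_extDom (hy.mem_finDom _ ha)) (hy.antitoneOn hN hf ha hb hab)

/-- Lower semicontinuity bounds the values near t from below, monotonicity those after t from above.
This argument gives right continuity only, which is why right derivatives are used for the clock. -/
lemma tendsto_expVal (hN : N < 0) (hf : LowerSemicontinuous f) (hy : IsEVICurve K N f T y) {t : ℝ}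
    (ht : t ∈ timeDom T) :
    Tendsto (fun r => expVal N f (y r)) (𝓝[≥] t) (𝓝 (expVal N f (y t))) := by
  have hsub : ∀ᶠ r in 𝓝[≥] t, r ∈ timeDom T :=
    mem_nhdsWithin_of_mem_nhds (isOpen_timeDom.mem_nhds ht)
  refine tendsto_order.2 ⟨fun c hc => ?_, fun c hc => ?_⟩
  · have := eventually_lt_expVal hN hf (hy.continuousOn t ht) hy.mem_finDom (hy.mem_finDom t ht) hc
    rw [isOpen_timeDom.nhdsWithin_eq ht] at this
    exact this.filter_mono nhdsWithin_le_nhds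
  · filter_upwards [hsub, self_mem_nhdsWithin] with r hr hrt
    exact (hy.expVal_antitoneOn hN hf ht hr hrt).trans_lt hc

end IsEVICurve

end EVI

/-! ### The change of time -/

namespace EVI

/-- An `EVI_{K,N}` curve after the change of time `ds = -N / f_N dt`. -/
structure IsRescaledCurve {X : Type*} [MetricSpace X] (K N : ℝ) (f : X → EReal) (S : EReal)
    (z : ℝ → X) : Prop where
  continuousOn : ContinuousOn z (timeDom S)
  mem_finDom : ∀ s ∈ timeDom S, z s ∈ finDom f
  antitoneOn : AntitoneOn (fun s => expVal N f (z s)) (timeDom S)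
  tendsto_expVal : ∀ s ∈ timeDom S,
    Tendsto (fun r => expVal N f (z r)) (𝓝[≥] s) (𝓝 (expVal N f (z s)))
  dini : ∀ s ∈ timeDom S, ∀ w ∈ extDom f, Admissible K N (dist (z s) w) →
    DiniLE (fun r => halfSq K N (dist (z r) w)) s
      ((expVal N f w - expVal N f (z s) * (1 + 2 * (-K / N) * halfSq K N (dist (z s) w))) / 2)

lemma IsRescaledCurve.mono {X : Type*} [MetricSpace X] {K N : ℝ} {f : X → EReal} {S S' : EReal}
    {z : ℝ → X} (h : IsRescaledCurve K N f S z) (hS : S' ≤ S) : IsRescaledCurve K N f S' z := by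
  have hsub : timeDom S' ⊆ timeDom S := fun s hs => ⟨hs.1, hs.2.trans_le hS⟩
  exact ⟨h.continuousOn.mono hsub, fun s hs => h.mem_finDom s (hsub hs), h.antitoneOn.mono hsub,
    fun s hs => h.tendsto_expVal s (hsub hs), fun s hs => h.dini s (hsub hs)⟩

/-- The inverse of the change of time `alpha`. -/
noncomputable def clock {X : Type*} (N : ℝ) (f : X → EReal) (T : EReal) (y : ℝ → X) : ℝ → ℝ :=
  Function.invFunOn (alpha N f y) (timeDom T)

lemma alpha_nonneg {X : Type*} {N : ℝ} {f : X → EReal} {T : EReal} {y : ℝ → X} (hN : N < 0) {t : ℝ}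
    (ht : t ∈ timeDom T) : 0 ≤ alpha N f y t :=
  mul_nonneg (by linarith)
    (intervalIntegral.integral_nonneg ht.1.le fun _ _ => one_div_nonneg.2 expVal_nonneg)

namespace IsEVICurve

variable {X : Type*} [MetricSpace X] {K N : ℝ} {f : X → EReal} {T : EReal} {y : ℝ → X}

lemma intervalIntegrable (hN : N < 0) (hf : LowerSemicontinuous f) (hy : IsEVICurve K N f T y)
    {t : ℝ} (ht : t ∈ timeDom T) :
    IntervalIntegrable (fun r => 1 / expVal N f (y r)) MeasureTheory.volume 0 t := by
  -- The point y 0 is arbitrary; with the value 0 there, the integrand is monotone on [0, t], hence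
  -- integrable.
  have hmono : MonotoneOn (fun r => if 0 < r then 1 / expVal N f (y r) else 0) (uIcc 0 t) := by
    rw [uIcc_of_le ht.1.le]
    intro a ha b hb hab
    dsimp only
    by_cases h : 0 < a
    · rw [if_pos h, if_pos (h.trans_le hab)]
      exact one_div_le_one_div_of_le
        (expVal_pos (hy.mem_finDom b (timeDom_of_le ht (h.trans_le hab) hb.2)))
        (hy.expVal_antitoneOn hN hf (timeDom_of_le ht h ha.2)
          (timeDom_of_le ht (h.trans_le hab) hb.2) hab)
    · rw [if_neg h]
      split_ifs
      · exact one_div_nonneg.2 expVal_nonneg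
      · exact le_rfl
  refine hmono.intervalIntegrable.congr fun r hr => ?_
  rw [uIoc_of_le ht.1.le] at hr
  exact if_pos hr.1

lemma alpha_sub (hN : N < 0) (hf : LowerSemicontinuous f) (hy : IsEVICurve K N f T y)
    {s t : ℝ} (hs : s ∈ timeDom T) (ht : t ∈ timeDom T) :
    alpha N f y t - alpha N f y s = -N * ∫ r in s..t, 1 / expVal N f (y r) := by
  rw [← intervalIntegral.integral_interval_sub_left (hy.intervalIntegrable hN hf ht)
    (hy.intervalIntegrable hN hf hs), mul_sub]
  rfl

/-- The integrand is nondecreasing, so its value at s bounds it from below. With `alpha_sub_le` this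
encloses the slopes of α, and so those of its inverse. -/
lemma le_alpha_sub (hN : N < 0) (hf : LowerSemicontinuous f) (hy : IsEVICurve K N f T y)
    {s t : ℝ} (hs : s ∈ timeDom T) (ht : t ∈ timeDom T) (hst : s ≤ t) :
    -N / expVal N f (y s) * (t - s) ≤ alpha N f y t - alpha N f y s := by
  have hint : IntervalIntegrable (fun r => 1 / expVal N f (y r)) MeasureTheory.volume s t :=
    (hy.intervalIntegrable hN hf hs).symm.trans (hy.intervalIntegrable hN hf ht)
  have := intervalIntegral.integral_mono_on hst (intervalIntegrable_const
    (c := 1 / expVal N f (y s))) hint fun r hr =>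
      one_div_le_one_div_of_le (expVal_pos (hy.mem_finDom r (Icc_subset_timeDom hs.1 ht hr)))
        (hy.expVal_antitoneOn hN hf hs (Icc_subset_timeDom hs.1 ht hr) hr.1)
  rw [intervalIntegral.integral_const, smul_eq_mul] at this
  rw [hy.alpha_sub hN hf hs ht]
  calc _ = -N * ((t - s) * (1 / expVal N f (y s))) := by ring
    _ ≤ _ := mul_le_mul_of_nonneg_left this (by linarith)

lemma alpha_sub_le (hN : N < 0) (hf : LowerSemicontinuous f) (hy : IsEVICurve K N f T y)
    {s t : ℝ} (hs : s ∈ timeDom T) (ht : t ∈ timeDom T) (hst : s ≤ t) :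
    alpha N f y t - alpha N f y s ≤ -N / expVal N f (y t) * (t - s) := by
  have hint : IntervalIntegrable (fun r => 1 / expVal N f (y r)) MeasureTheory.volume s t :=
    (hy.intervalIntegrable hN hf hs).symm.trans (hy.intervalIntegrable hN hf ht)
  have := intervalIntegral.integral_mono_on hst hint (intervalIntegrable_const
    (c := 1 / expVal N f (y t))) fun r hr =>
      one_div_le_one_div_of_le (expVal_pos (hy.mem_finDom t ht))
        (hy.expVal_antitoneOn hN hf (Icc_subset_timeDom hs.1 ht hr) ht hr.2)
  rw [intervalIntegral.integral_const, smul_eq_mul] at this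
  rw [hy.alpha_sub hN hf hs ht]
  calc _ ≤ -N * ((t - s) * (1 / expVal N f (y t))) :=
        mul_le_mul_of_nonneg_left this (by linarith)
    _ = _ := by ring

lemma alpha_strictMonoOn (hN : N < 0) (hf : LowerSemicontinuous f) (hy : IsEVICurve K N f T y) :
    StrictMonoOn (alpha N f y) (timeDom T) := by
  intro s hs t ht hst
  have h1 := hy.le_alpha_sub hN hf hs ht hst.le
  have h2 : 0 < -N / expVal N f (y s) * (t - s) :=
    mul_pos (div_pos (by linarith) (expVal_pos (hy.mem_finDom s hs))) (by linarith)
  linarith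

lemma alpha_continuousOn (hN : N < 0) (hf : LowerSemicontinuous f) (hy : IsEVICurve K N f T y) {t : ℝ}
    (ht : t ∈ timeDom T) : ContinuousOn (alpha N f y) (Icc 0 t) := by
  have hint := (intervalIntegrable_iff_integrableOn_Icc_of_le ht.1.le).1
    (hy.intervalIntegrable hN hf ht)
  rw [← uIcc_of_le ht.1.le] at hint
  have h := intervalIntegral.continuousOn_primitive_interval hint
  rw [uIcc_of_le ht.1.le] at h
  exact continuousOn_const.mul h

lemma alpha_mem (hN : N < 0) (hf : LowerSemicontinuous f) (hy : IsEVICurve K N f T y) {t : ℝ}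
    (ht : t ∈ timeDom T) : alpha N f y t ∈ timeDom (newTime N f T y) := by
  constructor
  · have h : t / 2 ∈ timeDom T := timeDom_of_le ht (half_pos ht.1) (by linarith [ht.1])
    exact (alpha_nonneg hN h).trans_lt
      (hy.alpha_strictMonoOn hN hf h ht (by linarith [ht.1]))
  · obtain ⟨s, hs, hts⟩ := exists_gt_mem_timeDom ht
    refine lt_of_lt_of_le (EReal.coe_lt_coe_iff.2 (hy.alpha_strictMonoOn hN hf ht hs hts)) ?_
    exact le_iSup₂ (f := fun t (_ : t ∈ timeDom T) => (alpha N f y t : EReal)) s hs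

lemma exists_alpha_eq (hN : N < 0) (hf : LowerSemicontinuous f) (hy : IsEVICurve K N f T y) {s : ℝ}
    (hs : s ∈ timeDom (newTime N f T y)) : ∃ t ∈ timeDom T, alpha N f y t = s := by
  obtain ⟨t, ht⟩ := lt_iSup_iff.1 hs.2
  obtain ⟨htT, hst⟩ := lt_iSup_iff.1 ht
  have h0 : alpha N f y 0 = 0 := by simp [alpha]
  obtain ⟨r, hr, hrs⟩ := intermediate_value_Icc htT.1.le (hy.alpha_continuousOn hN hf htT)
    (show s ∈ Icc _ _ from ⟨by rw [h0]; exact hs.1.le, (EReal.coe_lt_coe_iff.1 hst).le⟩)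
  refine ⟨r, timeDom_of_le htT (lt_of_le_of_ne hr.1 ?_) hr.2, hrs⟩
  rintro rfl
  exact hs.1.ne (h0.symm.trans hrs)

lemma clock_mem (hN : N < 0) (hf : LowerSemicontinuous f) (hy : IsEVICurve K N f T y) {s : ℝ}
    (hs : s ∈ timeDom (newTime N f T y)) : clock N f T y s ∈ timeDom T :=
  Function.invFunOn_mem (hy.exists_alpha_eq hN hf hs)

lemma alpha_clock (hN : N < 0) (hf : LowerSemicontinuous f) (hy : IsEVICurve K N f T y) {s : ℝ}
    (hs : s ∈ timeDom (newTime N f T y)) : alpha N f y (clock N f T y s) = s :=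
  Function.invFunOn_eq (hy.exists_alpha_eq hN hf hs)

lemma clock_alpha (hN : N < 0) (hf : LowerSemicontinuous f) (hy : IsEVICurve K N f T y) {t : ℝ}
    (ht : t ∈ timeDom T) : clock N f T y (alpha N f y t) = t :=
  (hy.alpha_strictMonoOn hN hf).injOn.leftInvOn_invFunOn ht

lemma clock_strictMonoOn (hN : N < 0) (hf : LowerSemicontinuous f) (hy : IsEVICurve K N f T y) :
    StrictMonoOn (clock N f T y) (timeDom (newTime N f T y)) := by
  intro a ha b hb hab
  rw [← (hy.alpha_strictMonoOn hN hf).lt_iff_lt (hy.clock_mem hN hf ha) (hy.clock_mem hN hf hb),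
    hy.alpha_clock hN hf ha, hy.alpha_clock hN hf hb]
  exact hab

lemma clock_sub_le (hN : N < 0) (hf : LowerSemicontinuous f) (hy : IsEVICurve K N f T y) {a b : ℝ}
    (ha : a ∈ timeDom (newTime N f T y)) (hb : b ∈ timeDom (newTime N f T y)) (hab : a ≤ b) :
    clock N f T y b - clock N f T y a ≤
      expVal N f (y (clock N f T y a)) / (-N) * (b - a) := by
  have h := hy.le_alpha_sub hN hf (hy.clock_mem hN hf ha) (hy.clock_mem hN hf hb)
    ((hy.clock_strictMonoOn hN hf).monotoneOn ha hb hab)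
  rw [hy.alpha_clock hN hf ha, hy.alpha_clock hN hf hb] at h
  have hpos := expVal_pos (N := N) (hy.mem_finDom _ (hy.clock_mem hN hf ha))
  rw [div_mul_eq_mul_div, div_le_iff₀ hpos] at h
  rw [div_mul_eq_mul_div, le_div_iff₀ (by linarith)]
  linarith

lemma le_clock_sub (hN : N < 0) (hf : LowerSemicontinuous f) (hy : IsEVICurve K N f T y) {a b : ℝ}
    (ha : a ∈ timeDom (newTime N f T y)) (hb : b ∈ timeDom (newTime N f T y)) (hab : a ≤ b) :
    expVal N f (y (clock N f T y b)) / (-N) * (b - a) ≤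
      clock N f T y b - clock N f T y a := by
  have h := hy.alpha_sub_le hN hf (hy.clock_mem hN hf ha) (hy.clock_mem hN hf hb)
    ((hy.clock_strictMonoOn hN hf).monotoneOn ha hb hab)
  rw [hy.alpha_clock hN hf ha, hy.alpha_clock hN hf hb] at h
  have hpos := expVal_pos (N := N) (hy.mem_finDom _ (hy.clock_mem hN hf hb))
  rw [div_mul_eq_mul_div, le_div_iff₀ hpos] at h
  rw [div_mul_eq_mul_div, div_le_iff₀ (by linarith)]
  linarith

lemma clock_continuousOn (hN : N < 0) (hf : LowerSemicontinuous f) (hy : IsEVICurve K N f T y) :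
    ContinuousOn (clock N f T y) (timeDom (newTime N f T y)) := by
  intro s hs
  have hs2 : s / 2 ∈ timeDom (newTime N f T y) :=
    timeDom_of_le hs (half_pos hs.1) (by linarith [hs.1])
  -- Since f_N decreases along the curve, its value at s / 2 yields a Lipschitz constant for the
  -- clock on all later times.
  set C := expVal N f (y (clock N f T y (s / 2))) / (-N)
  have hbound : ∀ a ∈ timeDom (newTime N f T y), ∀ b ∈ timeDom (newTime N f T y), s / 2 < a →
      a ≤ b → |clock N f T y b - clock N f T y a| ≤ C * |b - a| := fun a ha b hb hsa hab => by
    rw [abs_of_nonneg (sub_nonneg.2 ((hy.clock_strictMonoOn hN hf).monotoneOn ha hb hab)),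
      abs_of_nonneg (sub_nonneg.2 hab)]
    refine (hy.clock_sub_le hN hf ha hb hab).trans ?_
    refine mul_le_mul_of_nonneg_right (div_le_div_of_nonneg_right ?_ (by linarith))
      (sub_nonneg.2 hab)
    exact hy.expVal_antitoneOn hN hf (hy.clock_mem hN hf hs2) (hy.clock_mem hN hf ha)
      ((hy.clock_strictMonoOn hN hf).monotoneOn hs2 ha hsa.le)
  refine ContinuousAt.continuousWithinAt ?_
  rw [ContinuousAt, tendsto_iff_dist_tendsto_zero]
  have h0 : Tendsto (fun r => C * |r - s|) (𝓝 s) (𝓝 0) := by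
    have : Tendsto (fun r => C * |r - s|) (𝓝 s) (𝓝 (C * |s - s|)) :=
      Continuous.tendsto (by fun_prop) s
    simpa using this
  refine squeeze_zero' (Eventually.of_forall fun r => dist_nonneg) ?_ h0
  filter_upwards [isOpen_timeDom.mem_nhds hs, lt_mem_nhds (half_lt_self hs.1)] with r hr hr2
  rw [Real.dist_eq]
  rcases le_total s r with h | h
  · exact hbound s hs r hr (half_lt_self hs.1) h
  · rw [abs_sub_comm, abs_sub_comm r]
    exact hbound r hr s hs hr2 h

lemma tendsto_clock (hN : N < 0) (hf : LowerSemicontinuous f) (hy : IsEVICurve K N f T y) {s : ℝ}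
    (hs : s ∈ timeDom (newTime N f T y)) :
    Tendsto (clock N f T y) (𝓝[≥] s) (𝓝[≥] (clock N f T y s)) := by
  have hmem := isOpen_timeDom.mem_nhds hs
  refine tendsto_nhdsWithin_iff.2 ⟨?_, ?_⟩
  · exact ((hy.clock_continuousOn hN hf).continuousAt hmem).tendsto.mono_left nhdsWithin_le_nhds
  · filter_upwards [mem_nhdsWithin_of_mem_nhds hmem, self_mem_nhdsWithin] with r hr hsr
    exact (hy.clock_strictMonoOn hN hf).monotoneOn hs hr hsr

lemma tendsto_expVal_clock (hN : N < 0) (hf : LowerSemicontinuous f) (hy : IsEVICurve K N f T y)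
    {s : ℝ} (hs : s ∈ timeDom (newTime N f T y)) :
    Tendsto (fun r => expVal N f (y (clock N f T y r))) (𝓝[≥] s)
      (𝓝 (expVal N f (y (clock N f T y s)))) :=
  (hy.tendsto_expVal hN hf (hy.clock_mem hN hf hs)).comp (hy.tendsto_clock hN hf hs)

/-- The slope from s to r lies between the values of f_N/(-N) at r and at s, which merge as r ↓ s by
right continuity. -/
lemma hasDerivWithinAt_clock (hN : N < 0) (hf : LowerSemicontinuous f) (hy : IsEVICurve K N f T y)
    {s : ℝ} (hs : s ∈ timeDom (newTime N f T y)) :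
    HasDerivWithinAt (clock N f T y) (expVal N f (y (clock N f T y s)) / (-N)) (Ioi s) s := by
  rw [hasDerivWithinAt_iff_tendsto_slope' (by simp)]
  have hmem : timeDom (newTime N f T y) ∈ 𝓝[>] s :=
    mem_nhdsWithin_of_mem_nhds (isOpen_timeDom.mem_nhds hs)
  have hlim : Tendsto (fun r => expVal N f (y (clock N f T y r)) / (-N)) (𝓝[>] s)
      (𝓝 (expVal N f (y (clock N f T y s)) / (-N))) :=
    ((hy.tendsto_expVal_clock hN hf hs).mono_left
      (nhdsWithin_mono s Ioi_subset_Ici_self)).div_const _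
  refine tendsto_of_tendsto_of_tendsto_of_le_of_le' hlim tendsto_const_nhds ?_ ?_
  · filter_upwards [hmem, self_mem_nhdsWithin] with r hr hsr
    have hsr' : s < r := hsr
    rw [slope_def_field, le_div_iff₀ (sub_pos.2 hsr')]
    exact hy.le_clock_sub hN hf hs hr hsr'.le
  · filter_upwards [hmem, self_mem_nhdsWithin] with r hr hsr
    have hsr' : s < r := hsr
    rw [slope_def_field, div_le_iff₀ (sub_pos.2 hsr')]
    exact hy.clock_sub_le hN hf hs hr hsr'.le

/-- The clock tends to `0` at time `0`. -/
lemma tendsto_clock_zero (hN : N < 0) (hf : LowerSemicontinuous f) (hy : IsEVICurve K N f T y)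
    {s : ℝ} (hs : s ∈ timeDom (newTime N f T y)) : Tendsto (clock N f T y) (𝓝[>] 0) (𝓝[>] 0) := by
  have hsub : ∀ᶠ r in 𝓝[>] (0 : ℝ), r ∈ timeDom (newTime N f T y) := by
    filter_upwards [Ioo_mem_nhdsGT hs.1] with r hr using timeDom_of_le hs hr.1 hr.2.le
  refine tendsto_nhdsWithin_iff.2 ⟨?_, ?_⟩
  · refine tendsto_order.2 ⟨fun c hc => ?_, fun c hc => ?_⟩
    · filter_upwards [hsub] with r hr using hc.trans (hy.clock_mem hN hf hr).1
    · have hm : min c (clock N f T y s) ∈ timeDom T :=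
        timeDom_of_le (hy.clock_mem hN hf hs) (lt_min hc (hy.clock_mem hN hf hs).1)
          (min_le_right _ _)
      filter_upwards [hsub, Ioo_mem_nhdsGT (hy.alpha_mem hN hf hm).1] with r hr hr2
      refine lt_of_lt_of_le ?_ (min_le_left c (clock N f T y s))
      rw [← (hy.alpha_strictMonoOn hN hf).lt_iff_lt (hy.clock_mem hN hf hr) hm,
        hy.alpha_clock hN hf hr]
      exact hr2.2
  · filter_upwards [hsub] with r hr using (hy.clock_mem hN hf hr).1

/-- The chain rule multiplies the EVI by f_N/(-N) at the moving point, which clears the quotient on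
its right side. -/
theorem isRescaledCurve (hN : N < 0) (hf : LowerSemicontinuous f) (hy : IsEVICurve K N f T y) :
    IsRescaledCurve K N f (newTime N f T y) (reparam N f T y) where
  continuousOn := hy.continuousOn.comp (hy.clock_continuousOn hN hf) fun _ => hy.clock_mem hN hf
  mem_finDom s hs := hy.mem_finDom _ (hy.clock_mem hN hf hs)
  antitoneOn a ha b hb hab := hy.expVal_antitoneOn hN hf (hy.clock_mem hN hf ha)
    (hy.clock_mem hN hf hb) ((hy.clock_strictMonoOn hN hf).monotoneOn ha hb hab)
  tendsto_expVal s hs := hy.tendsto_expVal_clock hN hf hs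
  dini s hs w hw hA := by
    have hmem : timeDom (newTime N f T y) ∈ 𝓝[>] s :=
    mem_nhdsWithin_of_mem_nhds (isOpen_timeDom.mem_nhds hs)
    have hfin := hy.mem_finDom _ (hy.clock_mem hN hf hs)
    have hpos := expVal_pos (N := N) hfin
    have h := (hy.dini (hy.clock_mem hN hf hs) hw hA).comp_time
      (hy.hasDerivWithinAt_clock hN hf hs)
      (by
        filter_upwards [hmem, self_mem_nhdsWithin] with r hr hsr
        exact hy.clock_strictMonoOn hN hf hs hr hsr)
      (div_pos hpos (by linarith))
    refine h.mono (le_of_eq ?_)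
    have hN' := hN.ne
    have hpos' := hpos.ne'
    change _ = (expVal N f w - expVal N f (y (clock N f T y s)) *
      (1 + 2 * (-K / N) * halfSq K N (dist (y (clock N f T y s)) w))) / 2
    generalize expVal N f (y (clock N f T y s)) = F at *
    field_simp
    ring

end IsEVICurve

end EVI

/-! ### Contraction for K ≥ 0, local contraction for K < 0 -/

namespace EVI

/-- If `1 / c ≤ cos` on `[0, x']`, then `sin` detects growth up to the power `c`. -/
lemma le_exp_mul_of_sin_le {c a x x' : ℝ} (hc : 1 < c) (ha : 0 ≤ a) (hx : 0 ≤ x)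
    (hx' : x' < Real.arccos (1 / c)) (h : Real.sin x' ≤ Real.exp a * Real.sin x) :
    x' ≤ Real.exp (c * a) * x := by
  -- If x' > lx, then sin x' > sin(lx) ≥ sin x + cos(lx)(l - 1)x. Here cos(lx) > 1/c, and Bernoulli
  -- gives l - 1 ≥ c(eᵃ - 1), so the right side is at least sin x + (eᵃ - 1)x ≥ eᵃ sin x.
  by_contra! hlt
  set l := Real.exp (c * a)
  have hc0 : 0 < 1 / c := by positivity
  have hc1 : 1 / c ≤ 1 := (div_le_one (by linarith)).2 hc.le
  have hl1 : 1 ≤ l := Real.one_le_exp (by positivity)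
  have hpi : Real.arccos (1 / c) < Real.pi / 2 := Real.arccos_lt_pi_div_two.2 hc0
  have hxl : x ≤ l * x := by nlinarith
  have hcos : 1 / c < Real.cos (l * x) := by
    rw [← Real.cos_arccos (by linarith) hc1]
    refine Real.cos_lt_cos_of_nonneg_of_le_pi_div_two (by positivity) hpi.le (hlt.trans hx')
  have hsin : Real.sin (l * x) < Real.sin x' :=
    Real.sin_lt_sin_of_lt_of_le_pi_div_two (by linarith [Real.pi_pos]) (by linarith) hlt
  have hmv : Real.cos (l * x) * (l * x - x) ≤ Real.sin (l * x) - Real.sin x := by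
    refine Convex.mul_sub_le_image_sub_of_le_deriv (convex_Icc x (l * x))
      Real.continuous_sin.continuousOn Real.differentiable_sin.differentiableOn ?_ x
      ⟨le_rfl, hxl⟩ _ ⟨hxl, le_rfl⟩ hxl
    intro y hy
    rw [interior_Icc] at hy
    rw [Real.deriv_sin]
    exact Real.cos_le_cos_of_nonneg_of_le_pi (by linarith [hy.1]) (by linarith) hy.2.le
  have hbern : c * (Real.exp a - 1) ≤ l - 1 := by
    have h1 : l = (1 + (Real.exp a - 1)) ^ c := by
      rw [add_sub_cancel, ← Real.exp_mul, mul_comm]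
    have := one_add_mul_self_le_rpow_one_add (s := Real.exp a - 1)
      (by linarith [Real.exp_pos a]) hc.le
    rw [h1]; linarith
  have hsx : Real.sin x ≤ x := Real.sin_le hx
  have hsx0 : 0 ≤ Real.sin x := Real.sin_nonneg_of_nonneg_of_le_pi hx (by linarith)
  have hea : 0 ≤ Real.exp a - 1 := by linarith [Real.one_le_exp ha]
  have h2 : (Real.exp a - 1) * Real.sin x ≤ Real.cos (l * x) * (l * x - x) := by
    calc (Real.exp a - 1) * Real.sin x ≤ (Real.exp a - 1) * x :=
          mul_le_mul_of_nonneg_left hsx hea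
      _ = 1 / c * (c * (Real.exp a - 1) * x) := by field_simp
      _ ≤ 1 / c * ((l - 1) * x) :=
          mul_le_mul_of_nonneg_left (mul_le_mul_of_nonneg_right hbern hx) hc0.le
      _ ≤ Real.cos (l * x) * ((l - 1) * x) :=
          mul_le_mul_of_nonneg_right hcos.le (mul_nonneg (by linarith) hx)
      _ = _ := by ring
  linarith

namespace IsRescaledCurve

variable {X : Type*} [MetricSpace X] {K N : ℝ} {f : X → EReal} {S : EReal} {z z' : ℝ → X}

lemma continuousAt (hz : IsRescaledCurve K N f S z) {s : ℝ} (hs : s ∈ timeDom S) :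
    ContinuousAt z s :=
  hz.continuousOn.continuousAt (isOpen_timeDom.mem_nhds hs)

lemma continuousOn_dist (hz : IsRescaledCurve K N f S z) (hz' : IsRescaledCurve K N f S z') :
    ContinuousOn (fun s => dist (z s) (z' s)) (timeDom S) :=
  continuous_dist.comp_continuousOn (hz.continuousOn.prodMk hz'.continuousOn)

lemma eventually_admissible (hz : IsRescaledCurve K N f S z) (hz' : IsRescaledCurve K N f S z')
    {s : ℝ} (hs : s ∈ timeDom S) (hA : Admissible K N (dist (z s) (z' s))) :
    ∀ᶠ r in 𝓝 s, Admissible K N (dist (z r) (z' r)) :=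
  ((hz.continuousOn_dist hz').continuousAt (isOpen_timeDom.mem_nhds hs)).eventually hA.eventually

/-- The differential inequality for the distance of two curves. -/
lemma dini_dist (hz : IsRescaledCurve K N f S z) (hz' : IsRescaledCurve K N f S z') {s : ℝ}
    (hs : s ∈ timeDom S) (hA : Admissible K N (dist (z s) (z' s))) :
    DiniLE (fun r => halfSq K N (dist (z r) (z' r))) s
      (K / N * (expVal N f (z s) + expVal N f (z' s)) * halfSq K N (dist (z s) (z' s))) := by
  have hdist : Tendsto (fun q : ℝ × ℝ => dist (z q.1) (z' q.2)) (𝓝 s ×ˢ 𝓝 s)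
      (𝓝 (dist (z s) (z' s))) :=
    ((hz.continuousAt hs).tendsto.comp tendsto_fst).dist
      ((hz'.continuousAt hs).tendsto.comp tendsto_snd)
  obtain ⟨W, hW, hWA⟩ := (eventually_prod_self_iff (r := fun a b =>
    Admissible K N (dist (z a) (z' b)))).1 (hdist.eventually hA.eventually)
  obtain ⟨ε, hε, hball⟩ := Metric.mem_nhds_iff.1 (inter_mem hW (isOpen_timeDom.mem_nhds hs))
  have hsub : Ico s (s + ε) ⊆ W ∩ timeDom S := fun r hr => hball <| by
    rw [Metric.mem_ball, Real.dist_eq, abs_of_nonneg (by linarith [hr.1])]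
    linarith [hr.2]
  have hU : Tendsto (fun q : ℝ × ℝ => halfSq K N (dist (z q.1) (z' q.2))) (𝓝[≥] s ×ˢ 𝓝[≥] s)
      (𝓝 (halfSq K N (dist (z s) (z' s)))) :=
    ((continuous_halfSq.tendsto _).comp hdist).mono_left
      (prod_mono nhdsWithin_le_nhds nhdsWithin_le_nhds)
  have hF : Tendsto (fun q : ℝ × ℝ => expVal N f (z q.1)) (𝓝[≥] s ×ˢ 𝓝[≥] s) _ :=
    (hz.tendsto_expVal s hs).comp tendsto_fst
  have hF' : Tendsto (fun q : ℝ × ℝ => expVal N f (z' q.2)) (𝓝[≥] s ×ˢ 𝓝[≥] s) _ :=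
    (hz'.tendsto_expVal s hs).comp tendsto_snd
  have key := DiniLE.diag (U := fun r t => halfSq K N (dist (z r) (z' t)))
    (a := fun r t => (expVal N f (z' t) - expVal N f (z r) *
      (1 + 2 * (-K / N) * halfSq K N (dist (z r) (z' t)))) / 2)
    (b := fun r t => (expVal N f (z r) - expVal N f (z' t) *
      (1 + 2 * (-K / N) * halfSq K N (dist (z r) (z' t)))) / 2) hε
    (fun t _ => continuous_halfSq.comp_continuousOn
      ((continuous_id.dist continuous_const).comp_continuousOn
        (hz.continuousOn.mono fun r hr => (hsub hr).2)))
    (fun r _ => continuous_halfSq.comp_continuousOn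
      ((continuous_const.dist continuous_id).comp_continuousOn
        (hz'.continuousOn.mono fun r hr => (hsub hr).2)))
    (fun r hr t ht => hz.dini r (hsub hr).2 _ (finDom_subset_extDom (hz'.mem_finDom t (hsub ht).2))
      (hWA _ (hsub hr).1 _ (hsub ht).1))
    (fun r hr t ht => by
      have hA' := hWA _ (hsub hr).1 _ (hsub ht).1
      simp only [dist_comm (z r)] at hA' ⊢
      exact hz'.dini t (hsub ht).2 _ (finDom_subset_extDom (hz.mem_finDom r (hsub hr).2)) hA')
    ((hF'.sub (hF.mul ((hU.const_mul _).const_add _))).div_const _)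
    ((hF.sub (hF'.mul ((hU.const_mul _).const_add _))).div_const _)
  -- In the sum of the two bounds on the diagonal the free terms cancel; only the multiples of h
  -- remain.
  refine key.mono (le_of_eq ?_)
  ring

/-- The contraction estimate for `K ≥ 0`. -/
lemma dist_le_dist (hN : N < 0) (hK : 0 ≤ K) (hz : IsRescaledCurve K N f S z)
    (hz' : IsRescaledCurve K N f S z') {r s : ℝ} (hr : 0 < r) (hrs : r ≤ s) (hs : s ∈ timeDom S) :
    dist (z s) (z' s) ≤ dist (z r) (z' r) := by
  have hsub := Icc_subset_timeDom hr hs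
  refine le_of_halfSq_le (K := K) (N := N) hN hK dist_nonneg ?_
  have := DiniLE.sub_le (u := fun r => halfSq K N (dist (z r) (z' r))) (c := 0) hrs
    (continuous_halfSq.comp_continuousOn ((hz.continuousOn_dist hz').mono hsub)) fun q hq => by
      refine (hz.dini_dist hz' (hsub (Ico_subset_Icc_self hq)) (admissible_of_nonneg hK _)).mono ?_
      refine mul_nonpos_of_nonpos_of_nonneg (mul_nonpos_of_nonpos_of_nonneg ?_ ?_) (halfSq_nonneg _)
      · exact div_nonpos_of_nonneg_of_nonpos hK hN.le
      · exact add_nonneg expVal_nonneg expVal_nonneg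
  linarith

/-- Grönwall's inequality for two curves below a common level. -/
lemma halfSq_dist_le (hz : IsRescaledCurve K N f S z)
    (hz' : IsRescaledCurve K N f S z') {r s C : ℝ} (hr : 0 < r) (hrs : r ≤ s) (hs : s ∈ timeDom S)
    (hA : ∀ q ∈ Ico r s, Admissible K N (dist (z q) (z' q))) (hC : expVal N f (z r) ≤ C)
    (hC' : expVal N f (z' r) ≤ C) :
    halfSq K N (dist (z s) (z' s)) ≤
      Real.exp (2 * (|K / N| * C) * (s - r)) * halfSq K N (dist (z r) (z' r)) := by
  have hsub := Icc_subset_timeDom hr hs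
  refine DiniLE.gronwall (u := fun r => halfSq K N (dist (z r) (z' r))) hrs
    (continuous_halfSq.comp_continuousOn ((hz.continuousOn_dist hz').mono hsub)) fun q hq => ?_
  have hq' := hsub (Ico_subset_Icc_self hq)
  refine (hz.dini_dist hz' hq' (hA q hq)).mono (mul_le_mul_of_nonneg_right ?_ (halfSq_nonneg _))
  have h1 := (hz.antitoneOn (timeDom_of_le hs hr hrs) hq' hq.1).trans hC
  have h2 := (hz'.antitoneOn (timeDom_of_le hs hr hrs) hq' hq.1).trans hC'
  have h3 : 0 ≤ expVal N f (z q) + expVal N f (z' q) := add_nonneg expVal_nonneg expVal_nonneg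
  calc _ ≤ |K / N| * (expVal N f (z q) + expVal N f (z' q)) :=
        mul_le_mul_of_nonneg_right (le_abs_self _) h3
    _ ≤ |K / N| * (2 * C) := mul_le_mul_of_nonneg_left (by dsimp only at h1 h2; linarith) (abs_nonneg _)
    _ = _ := by ring

/-- Two curves that meet coincide from then on. -/
lemma eq_of_eq (hN : N < 0) (hz : IsRescaledCurve K N f S z) (hz' : IsRescaledCurve K N f S z')
    {r s : ℝ} (hr : 0 < r) (hrs : r ≤ s) (hs : s ∈ timeDom S) (h : z r = z' r) : z s = z' s := by
  have hsub := Icc_subset_timeDom hr hs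
  -- Admissibility is known only near a meeting time, so Grönwall is used locally: the set of
  -- meeting times is closed and extends to the right of each of its points.
  have hclosed : IsClosed ({q | dist (z q) (z' q) = 0} ∩ Icc r s) := by
    rw [inter_comm]
    exact ((hz.continuousOn_dist hz').mono hsub).preimage_isClosed_of_isClosed isClosed_Icc
      (isClosed_singleton (x := (0 : ℝ)))
  have := hclosed.Icc_subset_of_forall_mem_nhdsWithin (by simp [h]) (fun q hq => ?_)
    (right_mem_Icc.2 hrs)
  · exact dist_eq_zero.1 this
  · have hq0 : dist (z q) (z' q) = 0 := hq.1
    have hqS := hsub (Ico_subset_Icc_self hq.2)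
    have hev := hz.eventually_admissible hz' hqS (by rw [hq0]; exact admissible_zero hN)
    obtain ⟨ε, hε, hball⟩ := Metric.mem_nhds_iff.1 (inter_mem hev (isOpen_timeDom.mem_nhds hqS))
    filter_upwards [Ioo_mem_nhdsGT (show q < q + ε by linarith)] with p hp
    have hmem : ∀ a ∈ Icc q p, Admissible K N (dist (z a) (z' a)) ∧ a ∈ timeDom S := fun a ha =>
      hball <| by
        rw [Metric.mem_ball, Real.dist_eq, abs_of_nonneg (by linarith [ha.1])]
        linarith [ha.2, hp.2]
    have hp' := hmem p ⟨hp.1.le, le_rfl⟩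
    have key := hz.halfSq_dist_le hz' hqS.1 hp.1.le hp'.2
      (fun a ha => (hmem a (Ico_subset_Icc_self ha)).1) (le_max_left _ _) (le_max_right _ _)
    rw [hq0, halfSq_zero, mul_zero] at key
    exact eq_zero_of_halfSq_le_zero hN dist_nonneg hp'.1 key

/-- The local contraction estimate for `K < 0`. -/
lemma exists_dist_le (hN : N < 0) (hK : K < 0) (hz : IsRescaledCurve K N f S z)
    (hz' : IsRescaledCurve K N f S z') {c r : ℝ} (hc : 1 < c) (hr : r ∈ timeDom S)
    (h : √(K / N) * dist (z r) (z' r) / 2 < Real.arccos (1 / c)) :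
    ∃ ε, 0 < ε ∧ r + ε ∈ timeDom S ∧ ∀ s, r ≤ s → s < r + ε → dist (z s) (z' s) ≤
      Real.exp (c * (K / N * max (expVal N f (z r)) (expVal N f (z' r))) * (s - r)) *
        dist (z r) (z' r) := by
  have hk := sqrt_div_pos hN hK
  have hpi : Real.arccos (1 / c) < Real.pi / 2 := Real.arccos_lt_pi_div_two.2 (by positivity)
  have hev : ∀ᶠ s in 𝓝 r, √(K / N) * dist (z s) (z' s) / 2 < Real.arccos (1 / c) := by
    have h1 := (hz.continuousOn_dist hz').continuousAt (isOpen_timeDom.mem_nhds hr)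
    exact ((h1.const_mul (√(K / N))).div_const 2).eventually_lt_const h
  obtain ⟨ε, hε, hball⟩ := Metric.mem_nhds_iff.1 (inter_mem hev (isOpen_timeDom.mem_nhds hr))
  have hmem : ∀ s, r ≤ s → s < r + ε →
      √(K / N) * dist (z s) (z' s) / 2 < Real.arccos (1 / c) ∧ s ∈ timeDom S := fun s h1 h2 =>
    hball <| by
      rw [Metric.mem_ball, Real.dist_eq, abs_of_nonneg (by linarith)]
      linarith
  refine ⟨ε / 2, half_pos hε, (hmem (r + ε / 2) (by linarith) (by linarith)).2,
    fun s hrs hs => ?_⟩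
  have hs' := hmem s hrs (by linarith)
  set C := max (expVal N f (z r)) (expVal N f (z' r))
  have hC0 : 0 ≤ C := expVal_nonneg.trans (le_max_left _ _)
  have key := hz.halfSq_dist_le hz' hr.1 hrs hs'.2 (C := C)
    (fun q hq => (admissible_iff_of_neg hN hK).2
      (by linarith [(hmem q hq.1 (by linarith [hq.2])).1])) (le_max_left _ _) (le_max_right _ _)
  have hKN : 0 < K / N := div_pos_of_neg_of_neg hK hN
  rw [halfSq_of_neg hK, halfSq_of_neg hK, ← mul_div_assoc,
    div_le_div_iff_of_pos_right (by positivity), abs_of_pos hKN] at key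
  -- h is a multiple of a squared sine; taking the root halves the exponent.
  have hexp : Real.exp (2 * (K / N * C) * (s - r)) = Real.exp (K / N * C * (s - r)) ^ 2 := by
    rw [← Real.exp_nat_mul]; congr 1; push_cast; ring
  rw [hexp, ← mul_pow] at key
  have hsin : 0 ≤ Real.sin (√(K / N) * dist (z r) (z' r) / 2) :=
    Real.sin_nonneg_of_nonneg_of_le_pi (by positivity) (by linarith [Real.pi_pos])
  have h2 := (le_abs_self _).trans (abs_le_of_sq_le_sq key (by positivity))
  have h3 := le_exp_mul_of_sin_le hc
    (mul_nonneg (mul_nonneg hKN.le hC0) (sub_nonneg.2 hrs)) (by positivity) hs'.1 h2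
  rw [show c * (K / N * C * (s - r)) = c * (K / N * C) * (s - r) by ring] at h3
  have h4 : √(K / N) / 2 * dist (z s) (z' s) ≤ √(K / N) / 2 *
      (Real.exp (c * (K / N * C) * (s - r)) * dist (z r) (z' r)) := by
    calc _ = √(K / N) * dist (z s) (z' s) / 2 := by ring
      _ ≤ _ := h3
      _ = _ := by ring
  exact le_of_mul_le_mul_left h4 (by positivity)

/-- Curves below a common level whose distance tends to `0` at time `0` coincide. -/
lemma eq_of_tendsto (hN : N < 0) (hz : IsRescaledCurve K N f S z)
    (hz' : IsRescaledCurve K N f S z') {C : ℝ} (hC : ∀ s ∈ timeDom S, expVal N f (z s) ≤ C)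
    (hC' : ∀ s ∈ timeDom S, expVal N f (z' s) ≤ C)
    (h : Tendsto (fun s => dist (z s) (z' s)) (𝓝[>] 0) (𝓝 0)) {s : ℝ} (hs : s ∈ timeDom S) :
    z s = z' s := by
  obtain ⟨e, he, hA⟩ := (nhdsGT_basis (0 : ℝ)).eventually_iff.1
    (h.eventually (admissible_zero (K := K) hN).eventually)
  have he0 : (0 : ℝ) < e := he
  set b := min s (e / 2)
  have hb : 0 < b := lt_min hs.1 (by linarith)
  have hbe : b < e := (min_le_right _ _).trans_lt (by linarith)
  have hbS : b ∈ timeDom S := timeDom_of_le hs hb (min_le_left _ _)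
  refine hz.eq_of_eq hN hz' hb (min_le_left _ _) hs (dist_eq_zero.1 ?_)
  refine eq_zero_of_halfSq_le_zero (K := K) hN dist_nonneg (hA ⟨hb, hbe⟩) ?_
  have hlim : Tendsto (fun a => Real.exp (2 * (|K / N| * C) * (b - a)) *
      halfSq K N (dist (z a) (z' a))) (𝓝[>] 0)
      (𝓝 (Real.exp (2 * (|K / N| * C) * (b - 0)) * halfSq K N 0)) := by
    refine Tendsto.mul ?_ ((continuous_halfSq.tendsto 0).comp h)
    exact (Continuous.tendsto (by fun_prop) 0).mono_left nhdsWithin_le_nhds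
  rw [halfSq_zero, mul_zero] at hlim
  refine ge_of_tendsto hlim ?_
  filter_upwards [Ioo_mem_nhdsGT hb] with a ha
  have haS := timeDom_of_le hbS ha.1 ha.2.le
  exact hz.halfSq_dist_le hz' ha.1 ha.2.le hbS
    (fun q hq => hA ⟨ha.1.trans_le hq.1, hq.2.trans hbe⟩) (hC a haS) (hC' a haS)

end IsRescaledCurve

end EVI

/-! ### Chains of points and global contraction for K < 0 -/

namespace EVI

section Convexity

variable {X : Type*} [MetricSpace X] {K N : ℝ} {f : X → EReal}

/-- With x = √(K/N)d/2 ≤ δ, the coefficient for d > 0 is sin x / sin 2x = 1/(2 cos x). The infinite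
branch would need x ≥ π/2. -/
lemma distortion_half_le (hN : N < 0) (hK : K < 0) {d δ : ℝ} (hd : 0 ≤ d)
    (hdδ : √(K / N) * d ≤ 2 * δ) (hδ : δ < Real.pi / 2) :
    distortion K N (1 / 2) d ≤ ENNReal.ofReal (1 / (2 * Real.cos δ)) := by
  have hk := sqrt_div_pos hN hK
  have hδ0 : 0 ≤ δ := by nlinarith [mul_nonneg hk.le hd]
  have hcos : 0 < Real.cos δ := Real.cos_pos_of_mem_Ioo ⟨by linarith, hδ⟩
  unfold distortion
  split_ifs with h1 h2
  · refine ENNReal.ofReal_le_ofReal ?_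
    exact one_div_le_one_div_of_le (by positivity) (by linarith [Real.cos_le_one δ])
  · exfalso
    have h3 : Real.pi ^ 2 ≤ (√(K / N) * d) ^ 2 := by
      rw [mul_pow, sq_sqrt_div hN hK, div_mul_eq_mul_div, le_div_iff_of_neg hN]
      linarith
    have h4 := (abs_le_of_sq_le_sq h3 (by positivity))
    rw [abs_of_pos Real.pi_pos] at h4
    linarith
  · refine ENNReal.ofReal_le_ofReal ?_
    have hd0 : 0 < d := lt_of_le_of_ne hd fun h => h1 (by rw [← h]; ring)
    set x := √(K / N) * d / 2 with hx
    have hx0 : 0 < x := by positivity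
    have hsin : 0 < Real.sin x := Real.sin_pos_of_pos_of_lt_pi hx0 (by linarith)
    have hcosx : Real.cos δ ≤ Real.cos x :=
      Real.cos_le_cos_of_nonneg_of_le_pi hx0.le (by linarith) (by linarith)
    have e1 : genSin K N (1 / 2 * d) = Real.sin x / √(K / N) := by
      rw [genSin, if_pos hK]; congr 2; rw [hx]; ring
    have e2 : genSin K N d = 2 * Real.sin x * Real.cos x / √(K / N) := by
      rw [genSin, if_pos hK, ← Real.sin_two_mul]; congr 2; rw [hx]; ring
    rw [e1, e2, div_div_div_cancel_right₀ hk.ne']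
    have e3 : Real.sin x / (2 * Real.sin x * Real.cos x) = 1 / (2 * Real.cos x) := by
      field_simp
    rw [e3]
    exact one_div_le_one_div_of_le (by positivity) (by linarith)

/-- Midpoint form of `(K,N)`-convexity for `K < 0`. -/
lemma IsKNConvex.exists_midpoint (hN : N < 0) (hK : K < 0) (hconv : IsKNConvex K N f)
    {x₀ x₁ : X} (h₀ : x₀ ∈ extDom f) (h₁ : x₁ ∈ extDom f) {δ : ℝ}
    (hdδ : √(K / N) * dist x₀ x₁ ≤ 2 * δ) (hδ : δ < Real.pi / 2) :
    ∃ w, dist x₀ w = dist x₀ x₁ / 2 ∧ dist w x₁ = dist x₀ x₁ / 2 ∧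
      2 * Real.cos δ * expVal N f w ≤ expVal N f x₀ + expVal N f x₁ := by
  have hδ0 : 0 ≤ δ := by nlinarith [mul_nonneg (sqrt_div_pos hN hK).le (dist_nonneg (x := x₀) (y := x₁))]
  have hcos : 0 < Real.cos δ := Real.cos_pos_of_mem_Ioo ⟨by linarith, hδ⟩
  obtain ⟨γ, hγ, rfl, rfl, hle⟩ := hconv x₀ h₀ x₁ h₁
    ((admissible_iff_of_neg hN hK).2 (by linarith))
  let m : unitInterval := ⟨1 / 2, by norm_num, by norm_num⟩
  refine ⟨γ m, ?_, ?_, ?_⟩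
  · rw [hγ]
    simp only [m, Set.Icc.coe_zero, sub_zero]
    rw [abs_of_pos (by norm_num)]; ring
  · rw [hγ]
    simp only [m, Set.Icc.coe_one]
    rw [abs_of_pos (by norm_num)]; ring
  · have h1 := hle m
    have h2 : distortion K N (1 - (m : ℝ)) (dist (γ 0) (γ 1)) ≤
        ENNReal.ofReal (1 / (2 * Real.cos δ)) := by
      have : 1 - (m : ℝ) = 1 / 2 := by simp only [m]; norm_num
      rw [this]; exact distortion_half_le hN hK dist_nonneg hdδ hδ
    have h3 : distortion K N (m : ℝ) (dist (γ 0) (γ 1)) ≤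
        ENNReal.ofReal (1 / (2 * Real.cos δ)) := distortion_half_le hN hK dist_nonneg hdδ hδ
    have h4 : fN N f (γ m) ≤
        ENNReal.ofReal (1 / (2 * Real.cos δ) * (expVal N f (γ 0) + expVal N f (γ 1))) := by
      refine h1.trans ?_
      rw [ENNReal.ofReal_mul (by positivity), ENNReal.ofReal_add expVal_nonneg expVal_nonneg,
        mul_add, expVal, expVal, ENNReal.ofReal_toReal (fN_ne_top hN h₀),
        ENNReal.ofReal_toReal (fN_ne_top hN h₁)]
      gcongr
    have h5 : expVal N f (γ m) ≤ 1 / (2 * Real.cos δ) * (expVal N f (γ 0) + expVal N f (γ 1)) :=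
      ENNReal.toReal_le_of_le_ofReal
        (mul_nonneg (by positivity) (add_nonneg expVal_nonneg expVal_nonneg)) h4
    rw [one_div_mul_eq_div, le_div_iff₀ (by positivity)] at h5
    linarith

/-- Between two points there is a chain with equal steps that is almost discretely convex. -/
lemma IsKNConvex.exists_chain (hN : N < 0) (hK : K < 0) (hX : IsStrictlyIntrinsic X)
    (hconv : IsKNConvex K N f) (hdom : ∀ x, x ∈ extDom f) (x x' : X) {m : ℕ} (hm : 0 < m) {δ : ℝ}
    (hδ : √(K / N) * (dist x x' / m) ≤ δ) (hδ2 : δ < Real.pi / 2) {η : ℝ} (hη : 0 < η) :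
    ∃ p : ℕ → X, p 0 = x ∧ p m = x' ∧ (∀ i < m, dist (p i) (p (i + 1)) ≤ dist x x' / m) ∧
      ∀ i, i + 1 < m → 2 * Real.cos δ * (expVal N f (p (i + 1)) - η) ≤
        expVal N f (p i) + expVal N f (p (i + 2)) := by
  have hk := sqrt_div_pos hN hK
  have hm' : (0 : ℝ) < m := by exact_mod_cast hm
  have hδ0 : 0 ≤ δ := le_trans (by positivity) hδ
  have hcos : 0 < Real.cos δ := Real.cos_pos_of_mem_Ioo ⟨by linarith, hδ2⟩
  -- Only upper bounds on the steps are imposed, so that the class is stable under replacing an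
  -- interior point by a midpoint of its neighbours.
  set IsChain : (ℕ → X) → Prop := fun p => p 0 = x ∧ p m = x' ∧
    ∀ i < m, dist (p i) (p (i + 1)) ≤ dist x x' / m with hIsChain
  set A : Set ℝ := (fun p : ℕ → X => ∑ i ∈ Finset.range (m + 1), expVal N f (p i)) '' {p | IsChain p}
  have hne : A.Nonempty := by
    obtain ⟨γ, hγ, h0, h1⟩ := hX x x'
    have hproj : ∀ i ≤ m, ((projIcc (0 : ℝ) 1 zero_le_one (i / m) : unitInterval) : ℝ) = i / m := by
      intro i hi
      have : (i / m : ℝ) ∈ Icc (0 : ℝ) 1 :=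
        ⟨by positivity, (div_le_one hm').2 (by exact_mod_cast hi)⟩
      rw [projIcc_of_mem zero_le_one this]
    refine Set.Nonempty.image _ ⟨fun i => γ (projIcc (0 : ℝ) 1 zero_le_one (i / m)), ?_, ?_, ?_⟩
    · dsimp only
      rw [← h0]; congr 1; ext
      rw [hproj 0 (Nat.zero_le _)]; simp
    · dsimp only
      rw [← h1]; congr 1; ext
      rw [hproj m le_rfl]; simp [hm'.ne']
    · intro i hi
      dsimp only
      rw [hγ, hproj i hi.le, hproj (i + 1) hi, h0, h1]
      have : ((i + 1 : ℕ) / m - i / m : ℝ) = 1 / m := by push_cast; ring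
      rw [this, abs_of_pos (by positivity)]
      exact le_of_eq (by ring)
  have hbdd : BddBelow A := by
    refine ⟨0, ?_⟩
    rintro _ ⟨p, -, rfl⟩
    exact Finset.sum_nonneg fun _ _ => expVal_nonneg
  -- Without compactness a minimiser need not exist; one within η of the infimum suffices. Moving p
  -- (i + 1) to the midpoint w of its neighbours gains less than η, so the convexity bound at w
  -- passes to p (i + 1) up to η.
  obtain ⟨_, ⟨p, hp, rfl⟩, hpη⟩ := Real.lt_sInf_add_pos hne hη
  refine ⟨p, hp.1, hp.2.1, hp.2.2, fun i hi => ?_⟩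
  have hd2 : dist (p i) (p (i + 2)) ≤ 2 * (dist x x' / m) := by
    linarith [dist_triangle (p i) (p (i + 1)) (p (i + 2)), hp.2.2 i (by omega),
      hp.2.2 (i + 1) hi]
  obtain ⟨w, hw1, hw2, hw⟩ := hconv.exists_midpoint hN hK (hdom (p i)) (hdom (p (i + 2))) (δ := δ)
    (by nlinarith) hδ2
  have hchain : IsChain (Function.update p (i + 1) w) := by
    refine ⟨?_, ?_, fun j hj => ?_⟩
    · rw [Function.update_of_ne (by omega)]; exact hp.1
    · rw [Function.update_of_ne (by omega)]; exact hp.2.1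
    · rcases eq_or_ne j (i + 1) with rfl | h1
      · rw [Function.update_self, Function.update_of_ne (by omega)]
        linarith
      · rcases eq_or_ne j i with rfl | h2
        · rw [Function.update_self, Function.update_of_ne (by omega)]
          linarith
        · rw [Function.update_of_ne h1, Function.update_of_ne (by omega)]
          exact hp.2.2 j hj
  have hsum : ∑ j ∈ Finset.range (m + 1), expVal N f (Function.update p (i + 1) w j) =
      expVal N f w - expVal N f (p (i + 1)) + ∑ j ∈ Finset.range (m + 1), expVal N f (p j) := by
    have hmem : i + 1 ∈ Finset.range (m + 1) := Finset.mem_range.2 (by omega)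
    have h1 : ∀ j, expVal N f (Function.update p (i + 1) w j) =
        Function.update (fun j => expVal N f (p j)) (i + 1) (expVal N f w) j := fun j =>
      Function.apply_update (fun _ => expVal N f) p (i + 1) w j
    simp only [h1]
    rw [Finset.sum_update_of_mem hmem, ← Finset.add_sum_erase _ _ hmem,
      Finset.sdiff_singleton_eq_erase]
    ring
  have hinf := csInf_le hbdd (mem_image_of_mem _ hchain)
  dsimp only at hinf hpη
  rw [hsum] at hinf
  have h6 : expVal N f (p (i + 1)) - η ≤ expVal N f w := by linarith
  nlinarith

end Convexity

/-- Sum of discrete convexity inequalities. -/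
lemma sum_discrete_convex {G : ℕ → ℝ} {n : ℕ} {κ η C : ℝ} (hκ : 0 ≤ κ) (hκ1 : κ ≤ 1) (hη : 0 ≤ η)
    (hC : ∀ i, G i ≤ C)
    (h : ∀ i, i + 1 < n + 2 → 2 * κ * (G (i + 1) - η) ≤ G i + G (i + 2)) :
    G 1 + G (n + 1) - κ * (G 0 + G (n + 2)) ≤
      C * (2 * ((1 - κ) * (1 + (n + 1) * κ))) + 2 * (n + 1) * η := by
  set P := ∑ i ∈ Finset.range (n + 1), G (i + 1) with hP
  have e1 : ∑ i ∈ Finset.range (n + 1), G i = P + G 0 - G (n + 1) := by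
    have h1 := Finset.sum_range_succ G (n + 1)
    have h2 := Finset.sum_range_succ' G (n + 1)
    linarith
  have e2 : ∑ i ∈ Finset.range (n + 1), G (i + 2) = P + G (n + 2) - G 1 := by
    have h1 := Finset.sum_range_succ (fun i => G (i + 1)) (n + 1)
    have h2 := Finset.sum_range_succ' (fun i => G (i + 1)) (n + 1)
    simp only [add_assoc, zero_add, Nat.reduceAdd] at h1 h2
    simp only [hP]
    linarith
  have e3 := Finset.sum_le_sum (s := Finset.range (n + 1)) fun i hi =>
    h i (by have := Finset.mem_range.1 hi; omega)
  rw [Finset.sum_add_distrib, e1, e2, ← Finset.mul_sum, Finset.sum_sub_distrib, Finset.sum_const,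
    Finset.card_range, nsmul_eq_mul, ← hP] at e3
  push_cast at e3
  have e4 : P ≤ (n + 1) * C := by
    have := Finset.sum_le_sum (s := Finset.range (n + 1)) fun i _ => hC (i + 1)
    rw [Finset.sum_const, Finset.card_range, nsmul_eq_mul] at this
    push_cast at this
    exact this
  have hn : (0 : ℝ) ≤ n := Nat.cast_nonneg n
  -- The telescoped sum bounds G 1 + G (n + 1) by G 0 + G (n + 2) and errors. It is taken with
  -- weight κ, and the trivial bound 2C with weight 1 - κ, to produce the coefficient κ of the end
  -- values.
  have e5 : κ * (G 1 + G (n + 1)) ≤ κ * (G 0 + G (n + 2) + 2 * (1 - κ) * ((n + 1) * C)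
      + 2 * κ * ((n + 1) * η)) := by
    refine mul_le_mul_of_nonneg_left ?_ hκ
    have := mul_le_mul_of_nonneg_left e4 (sub_nonneg.2 hκ1)
    linarith
  have e6 : (1 - κ) * (G 1 + G (n + 1)) ≤ (1 - κ) * (2 * C) :=
    mul_le_mul_of_nonneg_left (by linarith [hC 1, hC (n + 1)]) (sub_nonneg.2 hκ1)
  have e7 : κ * (2 * κ * ((n + 1) * η)) ≤ 2 * (n + 1) * η := by
    have h1 : κ * κ ≤ 1 := by nlinarith
    have h2 : 0 ≤ 2 * ((n + 1) * η) := by positivity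
    nlinarith
  nlinarith

/-- In terms of x = δ/2 the claim follows from sin x (1 + (n + 1) cos 2x) ≤ (n + 2) x cos x. This
splits into sin x (1 + cos 2x) = 2 sin x cos² x ≤ 2x cos x and n copies of sin x cos 2x ≤ x cos x.
-/
lemma one_sub_cos_mul_le {δ : ℝ} (h0 : 0 ≤ δ) (hδ : δ < Real.pi / 2) (n : ℕ) :
    2 * ((1 - Real.cos δ) * (1 + (n + 1) * Real.cos δ)) ≤ (n + 2) * δ * Real.sin δ := by
  set x := δ / 2 with hx
  have hδx : δ = 2 * x := by rw [hx]; ring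
  rw [hδx, Real.cos_two_mul, Real.sin_two_mul]
  have hs : Real.sin x ≤ x := Real.sin_le (by linarith)
  have hs0 : 0 ≤ Real.sin x := Real.sin_nonneg_of_nonneg_of_le_pi (by linarith) (by linarith)
  have hc0 : 0 ≤ Real.cos x := Real.cos_nonneg_of_mem_Icc ⟨by linarith, by linarith⟩
  have hc1 := Real.cos_le_one x
  have hsq : Real.cos x ^ 2 = 1 - Real.sin x ^ 2 := by linarith [Real.sin_sq_add_cos_sq x]
  set s := Real.sin x
  set c := Real.cos x
  have hn : (0 : ℝ) ≤ n := Nat.cast_nonneg n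
  have h1 : s * (2 * c ^ 2 - 1) ≤ x * c := by
    have : 2 * c ^ 2 - 1 ≤ c := by nlinarith
    exact (mul_le_mul_of_nonneg_left this hs0).trans (mul_le_mul_of_nonneg_right hs hc0)
  have h2 : s * (2 * c ^ 2) ≤ 2 * (x * c) := by
    have h3 : s * c ≤ x * c := mul_le_mul_of_nonneg_right hs hc0
    have h4 : s * c * c ≤ s * c * 1 := mul_le_mul_of_nonneg_left hc1 (mul_nonneg hs0 hc0)
    nlinarith
  have h5 : s * (1 + (n + 1) * (2 * c ^ 2 - 1)) ≤ (n + 2) * (x * c) := by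
    have := mul_le_mul_of_nonneg_left h1 hn
    nlinarith
  calc 2 * ((1 - (2 * c ^ 2 - 1)) * (1 + (n + 1) * (2 * c ^ 2 - 1)))
      = 4 * s * (s * (1 + (n + 1) * (2 * c ^ 2 - 1))) := by
        have : 1 - (2 * c ^ 2 - 1) = 2 * s ^ 2 := by rw [hsq]; ring
        rw [this]; ring
    _ ≤ 4 * s * ((n + 2) * (x * c)) := mul_le_mul_of_nonneg_left h5 (by linarith)
    _ = _ := by ring

lemma hasDerivAt_halfSq {K N : ℝ} (hN : N < 0) (hK : K < 0) (d : ℝ) :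
    HasDerivAt (halfSq K N) (Real.sin (√(K / N) * d) / (2 * √(K / N))) d := by
  have hk := sqrt_div_pos hN hK
  have h : HasDerivAt (fun d => √(K / N) * d / 2) (√(K / N) * 1 / 2) d :=
    ((hasDerivAt_id d).const_mul _).div_const 2
  have h2 := (h.sin.pow 2).div_const (√(K / N) ^ 2)
  have h3 : halfSq K N = fun d => Real.sin (√(K / N) * d / 2) ^ 2 / √(K / N) ^ 2 :=
    funext (halfSq_of_neg hK)
  rw [h3]
  refine h2.congr_deriv ?_
  have : √(K / N) * d = 2 * (√(K / N) * d / 2) := by ring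
  rw [this, Real.sin_two_mul, ← this]
  field_simp
  push_cast
  ring

namespace IsRescaledCurve

variable {X : Type*} [MetricSpace X] {K N : ℝ} {f : X → EReal} {S : EReal} {z z' : ℝ → X}

/-- The evolution variational inequality for the distance itself, for `K < 0`. -/
lemma dini_dist_point (hN : N < 0) (hK : K < 0) (hz : IsRescaledCurve K N f S z) {s : ℝ}
    (hs : s ∈ timeDom S) {w : X} (hw : w ∈ extDom f) {δ : ℝ} (hδ : √(K / N) * dist (z s) w = δ)
    (h0 : 0 < δ) (hpi : δ < Real.pi) :
    DiniLE (fun r => dist (z r) w) s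
      (√(K / N) / Real.sin δ * (expVal N f w - expVal N f (z s) * Real.cos δ)) := by
  have hk := sqrt_div_pos hN hK
  have hsin : 0 < Real.sin δ := Real.sin_pos_of_pos_of_lt_pi h0 hpi
  have hA : Admissible K N (dist (z s) w) := (admissible_iff_of_neg hN hK).2 (by rwa [hδ])
  have hp := hasDerivAt_halfSq hN hK (dist (z s) w)
  rw [hδ] at hp
  have hcont : ContinuousWithinAt (fun r => dist (z r) w) (Ioi s) s :=
    ((continuous_id.dist continuous_const).continuousAt.comp
      (hz.continuousAt hs)).continuousWithinAt
  refine ((hz.dini s hs w hw hA).of_comp hp (by positivity) hcont).mono (le_of_eq ?_)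
  have hcos : 1 + 2 * (-K / N) * halfSq K N (dist (z s) w) = Real.cos δ := by
    have h1 : -K / N = -√(K / N) ^ 2 := by rw [sq_sqrt_div hN hK]; ring
    have h2 : Real.cos δ = 1 - 2 * Real.sin (δ / 2) ^ 2 := by
      have := Real.cos_two_mul (δ / 2)
      have h3 := Real.sin_sq_add_cos_sq (δ / 2)
      rw [show 2 * (δ / 2) = δ by ring] at this
      linarith
    rw [halfSq_of_neg hK, h1, hδ, h2]
    field_simp
    ring
  rw [hcos]
  field_simp

/-- The differential inequality for the distance under convexity and an upper bound. -/
lemma dini_dist_of_convex (hN : N < 0) (hK : K < 0) (hX : IsStrictlyIntrinsic X)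
    (hconv : IsKNConvex K N f) {C : ℝ} (hdom : ∀ x, x ∈ extDom f) (hC : ∀ x, expVal N f x ≤ C)
    (hz : IsRescaledCurve K N f S z) (hz' : IsRescaledCurve K N f S z') {s : ℝ}
    (hs : s ∈ timeDom S) :
    DiniLE (fun r => dist (z r) (z' r)) s (K / N * C * dist (z s) (z' s)) := by
  have hk := sqrt_div_pos hN hK
  -- At distance 0 the bound for the distance, which divides by sin δ, is unavailable; there the
  -- curves coincide from s on.
  rcases (dist_nonneg (x := z s) (y := z' s)).eq_or_lt with h0 | hpos
  · rw [← h0, mul_zero]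
    intro c hc
    filter_upwards [mem_nhdsWithin_of_mem_nhds (isOpen_timeDom.mem_nhds hs), self_mem_nhdsWithin]
      with r hr hsr
    have hsr' : s < r := hsr
    have := hz.eq_of_eq hN hz' hs.1 hsr'.le hr (dist_eq_zero.1 h0.symm)
    rw [this, dist_self, ← h0, sub_zero]
    exact mul_nonneg hc.le (sub_nonneg.2 hsr'.le)
  set D := dist (z s) (z' s) with hD
  -- The chain has n + 2 steps, each of angle δ < π/2, so that cos δ > 0 and two steps together stay
  -- admissible.
  obtain ⟨n, hn⟩ := exists_nat_gt (√(K / N) * D / (Real.pi / 2))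
  have hn0 : (0 : ℝ) ≤ n := Nat.cast_nonneg n
  have hm : (0 : ℝ) < n + 2 := by linarith
  set δ := √(K / N) * (D / (n + 2)) with hδ
  have hδ0 : 0 < δ := by positivity
  have hδ2 : δ < Real.pi / 2 := by
    rw [div_lt_iff₀ (by linarith [Real.pi_pos])] at hn
    rw [hδ, ← mul_div_assoc, div_lt_iff₀ hm]
    nlinarith [Real.pi_pos]
  have hsin : 0 < Real.sin δ := Real.sin_pos_of_pos_of_lt_pi hδ0 (by linarith)
  have hcos : 0 < Real.cos δ := Real.cos_pos_of_mem_Ioo ⟨by linarith, hδ2⟩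
  refine DiniLE.of_forall_lt fun b hb => ?_
  -- The total error 2(n + 1)η, multiplied by √(K/N)/sin δ, is exactly the slack b - (K/N)CD.
  set η := (b - K / N * C * D) * Real.sin δ / (√(K / N) * (2 * (n + 1))) with hη
  have hη0 : 0 < η := by
    have := sub_pos.2 hb
    positivity
  obtain ⟨p, hp0, hpm, hstep, hcv⟩ := hconv.exists_chain hN hK hX hdom (z s) (z' s)
    (m := n + 2) (by omega) (δ := δ) (by push_cast; exact le_rfl) hδ2 hη0
  push_cast at hstep
  rw [← hD] at hstep
  have hmid : dist (p 1) (p (n + 1)) ≤ n * (D / (n + 2)) := by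
    have h1 := dist_le_Ico_sum_of_dist_le (f := p) (d := fun _ => D / (n + 2))
      (show 1 ≤ n + 1 by omega) fun {i} _ hi => hstep i (by omega)
    rw [Finset.sum_const, Nat.card_Ico, nsmul_eq_mul, Nat.add_sub_cancel] at h1
    exact h1
  have hfirst := hstep 0 (by omega)
  have hlast := hstep (n + 1) (by omega)
  rw [zero_add, hp0] at hfirst
  rw [show n + 1 + 1 = n + 2 from rfl, hpm] at hlast
  have htot : n * (D / (n + 2)) + 2 * (D / (n + 2)) = D := by field_simp
  -- The upper bounds on the steps add up to D, so the first and last steps have exactly the length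
  -- D/(n + 2). The triangle inequality through p 1 and p (n + 1) is thus an equality at time s,
  -- which lets it be differentiated.
  have htri := dist_triangle4 (z s) (p 1) (p (n + 1)) (z' s)
  have e1 : dist (z s) (p 1) = D / (n + 2) := by linarith
  have e2 : dist (z' s) (p (n + 1)) = D / (n + 2) := by rw [dist_comm]; linarith
  have d1 := hz.dini_dist_point hN hK hs (hdom (p 1)) (δ := δ) (by rw [e1]) hδ0 (by linarith)
  have d2 := hz'.dini_dist_point hN hK hs (hdom (p (n + 1))) (δ := δ) (by rw [e2]) hδ0
    (by linarith)
  refine ((d1.add d2).of_le (u := fun r => dist (z r) (z' r)) (Eventually.of_forall fun r => ?_)).mono ?_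
  · have := dist_triangle4 (z r) (p 1) (p (n + 1)) (z' r)
    rw [dist_comm (p (n + 1)) (z' r)] at this
    rw [e1, e2, ← hD]
    linarith
  · have hsum := sum_discrete_convex (G := fun i => expVal N f (p i)) hcos.le (Real.cos_le_one δ)
      hη0.le (fun i => hC _) hcv
    rw [hp0, hpm] at hsum
    have hC0 : 0 ≤ C := expVal_nonneg.trans (hC (z s))
    have htrig := mul_le_mul_of_nonneg_left (one_sub_cos_mul_le hδ0.le hδ2 n) hC0
    have hδD : (n + 2) * δ = √(K / N) * D := by rw [hδ]; field_simp
    rw [hδD] at htrig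
    have hηeq : 2 * (n + 1) * η = (b - K / N * C * D) * Real.sin δ / √(K / N) := by
      rw [hη]; field_simp
    calc _ = √(K / N) / Real.sin δ * (expVal N f (p 1) + expVal N f (p (n + 1)) -
          Real.cos δ * (expVal N f (z s) + expVal N f (z' s))) := by ring
      _ ≤ √(K / N) / Real.sin δ * (C * (√(K / N) * D * Real.sin δ) +
          (b - K / N * C * D) * Real.sin δ / √(K / N)) := by
        refine mul_le_mul_of_nonneg_left ?_ (by positivity)
        rw [← hηeq]; linarith
      _ = √(K / N) ^ 2 * C * D + (b - K / N * C * D) := by field_simp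
      _ = b := by rw [sq_sqrt_div hN hK]; ring

/-- The contraction estimate for `K < 0` under convexity and an upper bound. -/
lemma dist_le_exp_mul (hN : N < 0) (hK : K < 0) (hX : IsStrictlyIntrinsic X)
    (hconv : IsKNConvex K N f) {M : ℝ} (hM : ∀ x, f x ≤ M)
    (hz : IsRescaledCurve K N f S z) (hz' : IsRescaledCurve K N f S z') {r s : ℝ}
    (hr : 0 < r) (hrs : r ≤ s) (hs : s ∈ timeDom S) :
    dist (z s) (z' s) ≤ Real.exp (-rate K N M * (s - r)) * dist (z r) (z' r) := by
  have hsub := Icc_subset_timeDom hr hs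
  have : -rate K N M = K / N * Real.exp (-M / N) := by rw [rate]; ring
  rw [this]
  exact DiniLE.gronwall (u := fun r => dist (z r) (z' r)) hrs
    ((hz.continuousOn_dist hz').mono hsub) fun q hq =>
      hz.dini_dist_of_convex hN hK hX hconv (fun x => (hM x).trans_lt (EReal.coe_lt_top M))
        (fun x => expVal_le_of_le_coe hN (hM x)) hz' (hsub (Ico_subset_Icc_self hq))

end IsRescaledCurve

end EVI

/-! ### Uniqueness -/

namespace EVI

lemma IsRescaledCurve.eq_of_dist_le {X : Type*} [MetricSpace X] {z z' : ℝ → X} {L s : ℝ}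
    (hs : 0 < s)
    (h : ∀ a, 0 < a → a ≤ s → dist (z s) (z' s) ≤ Real.exp (L * (s - a)) * dist (z a) (z' a))
    (h0 : Tendsto (fun a => dist (z a) (z' a)) (𝓝[>] 0) (𝓝 0)) : z s = z' s := by
  have hlim : Tendsto (fun a => Real.exp (L * (s - a)) * dist (z a) (z' a)) (𝓝[>] 0)
      (𝓝 (Real.exp (L * (s - 0)) * 0)) :=
    ((Continuous.tendsto (by fun_prop) 0).mono_left nhdsWithin_le_nhds).mul h0
  rw [mul_zero] at hlim
  refine dist_le_zero.1 (ge_of_tendsto hlim ?_)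
  filter_upwards [Ioo_mem_nhdsGT hs] with a ha using h a ha.1 ha.2.le

section Uniqueness

variable {X : Type*} [MetricSpace X] {K N : ℝ} {f : X → EReal} {T₁ T₂ : EReal} {y₁ y₂ : ℝ → X}

lemma IsEVICurve.tendsto_reparam (hN : N < 0) (hf : LowerSemicontinuous f)
    (hy : IsEVICurve K N f T₁ y₁) {y₀ : X} (h : StartsAt y₁ y₀) {s : ℝ}
    (hs : s ∈ timeDom (newTime N f T₁ y₁)) :
    Tendsto (reparam N f T₁ y₁) (𝓝[>] 0) (𝓝 y₀) :=
  h.comp (hy.tendsto_clock_zero hN hf hs)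

/-- If the reparametrized curves agree, so do the clocks. -/
lemma IsEVICurve.clock_eq (hN : N < 0) (hf : LowerSemicontinuous f) (h₁ : IsEVICurve K N f T₁ y₁)
    (h₂ : IsEVICurve K N f T₂ y₂) (hle : newTime N f T₁ y₁ ≤ newTime N f T₂ y₂)
    (heq : ∀ s ∈ timeDom (newTime N f T₁ y₁), reparam N f T₁ y₁ s = reparam N f T₂ y₂ s) {s : ℝ}
    (hs : s ∈ timeDom (newTime N f T₁ y₁)) : clock N f T₁ y₁ s = clock N f T₂ y₂ s := by
  have hsub : timeDom (newTime N f T₁ y₁) ⊆ timeDom (newTime N f T₂ y₂) :=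
    fun r hr => ⟨hr.1, hr.2.trans_le hle⟩
  set g : ℝ → ℝ := fun r => clock N f T₁ y₁ r - clock N f T₂ y₂ r with hg
  -- Both clocks have right derivative f_N/(-N) at the same point of X, so their difference is
  -- constant; it tends to 0 at time 0.
  have hconst : ∀ a ∈ Ioo 0 s, g s = g a := fun a ha => by
    have hsub' := Icc_subset_timeDom ha.1 hs
    refine constant_of_has_deriv_right_zero
      (((h₁.clock_continuousOn hN hf).mono hsub').sub
        ((h₂.clock_continuousOn hN hf).mono (hsub'.trans hsub))) (fun r hr => ?_) s
      (right_mem_Icc.2 ha.2.le)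
    have hr' := hsub' (Ico_subset_Icc_self hr)
    have hd := (h₁.hasDerivWithinAt_clock hN hf hr').sub
      (h₂.hasDerivWithinAt_clock hN hf (hsub hr'))
    have he : y₁ (clock N f T₁ y₁ r) = y₂ (clock N f T₂ y₂ r) := heq r hr'
    rw [he, sub_self] at hd
    exact hasDerivWithinAt_Ioi_iff_Ici.1 hd
  have hlim : Tendsto g (𝓝[>] 0) (𝓝 (0 - 0)) :=
    ((h₁.tendsto_clock_zero hN hf hs).mono_right nhdsWithin_le_nhds).sub
      ((h₂.tendsto_clock_zero hN hf (hsub hs)).mono_right nhdsWithin_le_nhds)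
  have hlim' : Tendsto g (𝓝[>] 0) (𝓝 (g s)) := by
    refine tendsto_const_nhds.congr' ?_
    filter_upwards [Ioo_mem_nhdsGT hs.1] with a ha using hconst a ha
  have := tendsto_nhds_unique hlim' hlim
  rw [sub_zero] at this
  exact sub_eq_zero.1 this

lemma IsEVICurve.eq_of_reparam_eq (hN : N < 0) (hf : LowerSemicontinuous f)
    (h₁ : IsEVICurve K N f T₁ y₁) (h₂ : IsEVICurve K N f T₂ y₂)
    (heq : ∀ s ∈ timeDom (min (newTime N f T₁ y₁) (newTime N f T₂ y₂)),
      reparam N f T₁ y₁ s = reparam N f T₂ y₂ s) {t : ℝ} (ht : t ∈ timeDom (min T₁ T₂)) :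
    y₁ t = y₂ t := by
  have ht₁ : t ∈ timeDom T₁ := ⟨ht.1, ht.2.trans_le (min_le_left _ _)⟩
  have ht₂ : t ∈ timeDom T₂ := ⟨ht.1, ht.2.trans_le (min_le_right _ _)⟩
  rcases le_total (newTime N f T₁ y₁) (newTime N f T₂ y₂) with hle | hle
  · rw [min_eq_left hle] at heq
    have hs := h₁.alpha_mem hN hf ht₁
    have hc := h₁.clock_eq hN hf h₂ hle heq hs
    have hz : y₁ (clock N f T₁ y₁ _) = y₂ (clock N f T₂ y₂ _) := heq _ hs
    rwa [← hc, h₁.clock_alpha hN hf ht₁] at hz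
  · rw [min_eq_right hle] at heq
    have hs := h₂.alpha_mem hN hf ht₂
    have hc := h₂.clock_eq hN hf h₁ hle (fun s hs => (heq s hs).symm) hs
    have hz : y₁ (clock N f T₁ y₁ _) = y₂ (clock N f T₂ y₂ _) := heq _ hs
    rwa [← hc, h₂.clock_alpha hN hf ht₂] at hz

/-- Uniqueness follows from uniqueness of the reparametrized curves. -/
lemma uniqueFrom_of_rescaled (hN : N < 0) (hf : LowerSemicontinuous f) {y₀ : X}
    (h : ∀ (T₁ T₂ : EReal) (y₁ y₂ : ℝ → X), IsEVICurve K N f T₁ y₁ → IsEVICurve K N f T₂ y₂ →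
      StartsAt y₁ y₀ → StartsAt y₂ y₀ → ∀ S, IsRescaledCurve K N f S (reparam N f T₁ y₁) →
      IsRescaledCurve K N f S (reparam N f T₂ y₂) →
      S = min (newTime N f T₁ y₁) (newTime N f T₂ y₂) → ∀ s ∈ timeDom S,
      Tendsto (fun a => dist (reparam N f T₁ y₁ a) (reparam N f T₂ y₂ a)) (𝓝[>] 0) (𝓝 0) →
      reparam N f T₁ y₁ s = reparam N f T₂ y₂ s) : UniqueFrom K N f y₀ := by
  intro T₁ T₂ y₁ y₂ h₁ h₂ hs₁ hs₂ t ht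
  refine h₁.eq_of_reparam_eq hN hf h₂ (fun s hs => ?_) ht
  refine h T₁ T₂ y₁ y₂ h₁ h₂ hs₁ hs₂ _ ((h₁.isRescaledCurve hN hf).mono (min_le_left _ _))
    ((h₂.isRescaledCurve hN hf).mono (min_le_right _ _)) rfl s hs ?_
  have := (h₁.tendsto_reparam hN hf hs₁ ⟨hs.1, hs.2.trans_le (min_le_left _ _)⟩).dist
    (h₂.tendsto_reparam hN hf hs₂ ⟨hs.1, hs.2.trans_le (min_le_right _ _)⟩)
  rwa [dist_self] at this

/-- The curves never rise above the level of y₀, so one Grönwall constant serves for all initial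
times a ↓ 0. -/
lemma uniqueFrom_of_mem_extDom (hN : N < 0) (hf : LowerSemicontinuous f) {y₀ : X}
    (h₀ : y₀ ∈ extDom f) : UniqueFrom K N f y₀ := by
  refine uniqueFrom_of_rescaled hN hf fun T₁ T₂ y₁ y₂ h₁ h₂ hs₁ hs₂ S hz₁ hz₂ hS s hs hlim => ?_
  subst hS
  refine hz₁.eq_of_tendsto hN hz₂ (C := expVal N f y₀) (fun r hr => ?_) (fun r hr => ?_) hlim hs
  · exact expVal_mono hN h₀ (h₁.le_of_startsAt hN hf h₀ hs₁
      (h₁.clock_mem hN hf ⟨hr.1, hr.2.trans_le (min_le_left _ _)⟩))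
  · exact expVal_mono hN h₀ (h₂.le_of_startsAt hN hf h₀ hs₂
      (h₂.clock_mem hN hf ⟨hr.1, hr.2.trans_le (min_le_right _ _)⟩))

lemma uniqueFrom_of_nonneg (hN : N < 0) (hK : 0 ≤ K) (hf : LowerSemicontinuous f) (y₀ : X) :
    UniqueFrom K N f y₀ := by
  refine uniqueFrom_of_rescaled hN hf fun T₁ T₂ y₁ y₂ _ _ _ _ S hz₁ hz₂ _ s hs hlim => ?_
  refine IsRescaledCurve.eq_of_dist_le (L := 0) hs.1 (fun a ha has => ?_) hlim
  rw [zero_mul, Real.exp_zero, one_mul]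
  exact hz₁.dist_le_dist hN hK hz₂ ha has hs

lemma uniqueFrom_of_convex (hN : N < 0) (hK : K < 0) (hX : IsStrictlyIntrinsic X)
    (hf : LowerSemicontinuous f) (hconv : IsKNConvex K N f) {M : ℝ} (hM : ∀ x, f x ≤ M) (y₀ : X) :
    UniqueFrom K N f y₀ := by
  refine uniqueFrom_of_rescaled hN hf fun T₁ T₂ y₁ y₂ _ _ _ _ S hz₁ hz₂ _ s hs hlim => ?_
  exact IsRescaledCurve.eq_of_dist_le hs.1
    (fun a ha has => hz₁.dist_le_exp_mul hN hK hX hconv hM hz₂ ha has hs) hlim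

end Uniqueness

lemma rate_max {X : Type*} {K N : ℝ} (hN : N < 0) {f : X → EReal} {x x' : X} (hx : x ∈ finDom f)
    (hx' : x' ∈ finDom f) :
    rate K N (max (f x).toReal (f x').toReal) =
      -(K / N * max (expVal N f x) (expVal N f x')) := by
  have hmono : Monotone fun a : ℝ => Real.exp (-a / N) := fun a b hab =>
    Real.exp_le_exp.2 (div_le_div_of_nonpos_of_le hN.le (neg_le_neg hab))
  rw [rate, expVal_of_mem hx, expVal_of_mem hx', neg_mul]
  exact congrArg (fun u => -(K / N * u)) (hmono.map_max)

end EVI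

theorem mainTheorem1 (K N : ℝ) (hN : N < 0) :
    -- a radius depending only on `K`, `N` and the number `c > 1` of part (iii)
    ∃ R : ℝ → ℝ, (∀ c, 1 < c → 0 < R c) ∧
    ∀ (X : Type*) [MetricSpace X] (_ : EVI.IsStrictlyIntrinsic X)
      (f : X → EReal) (_ : LowerSemicontinuous f),
      -- contraction estimates for the reparametrized curves
      (∀ (T₁ T₂ : EReal) (y₁ y₂ : ℝ → X),
        EVI.IsEVICurve K N f T₁ y₁ → EVI.IsEVICurve K N f T₂ y₂ →
        ∀ (S : EReal) (z₁ z₂ : ℝ → X),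
          S = min (EVI.newTime N f T₁ y₁) (EVI.newTime N f T₂ y₂) →
          z₁ = EVI.reparam N f T₁ y₁ → z₂ = EVI.reparam N f T₂ y₂ →
          -- (i)
          (0 ≤ K → ∀ r s : ℝ, 0 < r → r ≤ s → (s : EReal) < S →
            dist (z₁ s) (z₂ s) ≤ dist (z₁ r) (z₂ r)) ∧
          -- (ii)
          (K < 0 → EVI.IsKNConvex K N f → ∀ M : ℝ, (∀ x, f x ≤ (M : EReal)) →
            ∀ r s : ℝ, 0 < r → r ≤ s → (s : EReal) < S →
              dist (z₁ s) (z₂ s) ≤ Real.exp (-EVI.rate K N M * (s - r)) * dist (z₁ r) (z₂ r)) ∧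
          -- (iii)
          (K < 0 → ∀ c : ℝ, 1 < c → ∀ r : ℝ, 0 < r → (r : EReal) < S →
            dist (z₁ r) (z₂ r) < R c / 3 →
            ∃ ε : ℝ, 0 < ε ∧ ((r + ε : ℝ) : EReal) ≤ S ∧
              ∀ s : ℝ, r ≤ s → s < r + ε →
                dist (z₁ s) (z₂ s) ≤
                  Real.exp (-(c * EVI.rate K N (max (f (z₁ r)).toReal (f (z₂ r)).toReal)) * (s - r))
                    * dist (z₁ r) (z₂ r))) ∧
      -- uniqueness
      (∀ y₀ ∈ EVI.finDom f, EVI.UniqueFrom K N f y₀) ∧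
      (0 ≤ K → ∀ y₀ : X, EVI.UniqueFrom K N f y₀) ∧
      (K < 0 → EVI.IsKNConvex K N f → (∃ M : ℝ, ∀ x, f x ≤ (M : EReal)) →
        ∀ y₀ : X, EVI.UniqueFrom K N f y₀) := by
  refine ⟨fun c => if K < 0 then 6 * Real.arccos (1 / c) / √(K / N) else 1, fun c hc => ?_,
    fun X _ hX f hf => ⟨?_, fun y₀ h₀ => ?_, fun hK y₀ => ?_, ?_⟩⟩
  · dsimp only
    split_ifs with hK
    · have h1 : 0 < Real.arccos (1 / c) :=
        Real.arccos_pos.2 ((div_lt_one (by linarith)).2 hc)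
      have h2 := EVI.sqrt_div_pos hN hK
      positivity
    · exact one_pos
  · rintro T₁ T₂ y₁ y₂ h₁ h₂ S z₁ z₂ hS hz₁ hz₂
    have H₁ : EVI.IsRescaledCurve K N f S z₁ := by
      rw [hS, hz₁]; exact (h₁.isRescaledCurve hN hf).mono (min_le_left _ _)
    have H₂ : EVI.IsRescaledCurve K N f S z₂ := by
      rw [hS, hz₂]; exact (h₂.isRescaledCurve hN hf).mono (min_le_right _ _)
    refine ⟨fun hK r s hr hrs hs => H₁.dist_le_dist hN hK H₂ hr hrs ⟨hr.trans_le hrs, hs⟩,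
      fun hK hconv M hM r s hr hrs hs =>
        H₁.dist_le_exp_mul hN hK hX hconv hM H₂ hr hrs ⟨hr.trans_le hrs, hs⟩,
      fun hK c hc r hr hrS hd => ?_⟩
    have hk := EVI.sqrt_div_pos hN hK
    have hrS' : r ∈ EVI.timeDom S := ⟨hr, hrS⟩
    obtain ⟨ε, hε, hεS, hle⟩ := H₁.exists_dist_le hN hK H₂ hc hrS' (by
      dsimp only at hd
      rw [if_pos hK, div_div, lt_div_iff₀ (by positivity)] at hd
      linarith)
    refine ⟨ε, hε, hεS.2.le, fun s hrs hs => (hle s hrs hs).trans_eq ?_⟩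
    rw [EVI.rate_max hN (H₁.mem_finDom r hrS') (H₂.mem_finDom r hrS'), mul_neg, neg_neg]
  · exact EVI.uniqueFrom_of_mem_extDom hN hf (EVI.finDom_subset_extDom h₀)
  · exact EVI.uniqueFrom_of_nonneg hN hK hf y₀
  · rintro hK hconv ⟨M, hM⟩ y₀
    exact EVI.uniqueFrom_of_convex hN hK hX hf hconv hM y₀
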